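/- Let $d>2$, let $(\Omega,\mathcal F,\mathbb P)$ be a probability space with an ergodic measure-preserving action $\{\theta_k\}_{k\in\mathbb Z^d}$ of $\mathbb Z^d$, and let $e_1,\dots,e_d$ be the canonical basis of $\mathbb R^d$. Let $\Phi:\mathbb R^d\times\Omega\to\mathbb R^d$ be a random Lipschitz field (that is, $\Phi(x,\cdot)$ is measurable for every $x$ and $\Phi(\cdot,\omega)$ is Lipschitz for almost every $\omega$) with $\Phi(0,\cdot)\in L^2(\Omega,\mathbb R^d)$, whose gradient $\nabla\Phi$ (in $x$, defined almost everywhere) is uniformly bounded and stationary: for almost every $x\in\mathbb R^d$, all $k\in\mathbb Z^d$ and almost every $\omega\in\Omega$, $\nabla\Phi(x+k,\omega)=\nabla\Phi(x,\theta_k\omega)$. Assume that there are $\alpha>2$ and $C<\infty$ such that for almost every $x\in[0,1)^d$, all $k\in\mathbb Z^d$ and all $l,l',n\in\{1,\dots,d\}$, $$\mathrm{cov}\big[\partial_l\Phi(x+k)\cdot e_n;\ \partial_{l'}\Phi(x)\cdot e_n\big]\ \le\ \frac{C}{1+|k|^\alpha}.$$ Let $T$ be the deterministic $d\times d$ matrix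 with columns $Te_l=\mathbb E[\Phi(e_l,\cdot)-\Phi(0,\cdot)]$. Then there is a (jointly measurable) $[0,1)^d$-periodic random field $\tilde X\in W^{1,\infty}_{\mathrm{per}}([0,1)^d,L^2_0(\Omega,\mathbb R^d))$, where $L^2_0(\Omega,\mathbb R^d)$ is the space of square integrable random vectors with vanishing expectation, such that $\Phi+\tilde X$ is stationary up to the deterministic drift $T$: for all $x\in\mathbb R^d$, $k\in\mathbb Z^d$ and almost every $\omega\in\Omega$, $$\Phi(x+k,\omega)+\tilde X(x+k,\omega)\ =\ \Phi(x,\theta_k\omega)+\tilde X(x,\theta_k\omega)+Tk .$$ (In particular, if $T=0$, then $\Phi+\tilde X$ is stationary in the strict sense.) -/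

import Mathlib

open MeasureTheory ProbabilityTheory Filter Topology
open scoped ENNReal NNReal

/-- `ℝ^d` with its Euclidean norm. -/
abbrev Euc (d : ℕ) : Type := EuclideanSpace ℝ (Fin d)

/-- The canonical basis vector `e_l` of `ℝ^d`. -/
noncomputable def basisVec {d : ℕ} (l : Fin d) : Euc d := EuclideanSpace.single l (1 : ℝ)

/-- The point of `ℝ^d` given by `k ∈ ℤ^d`. -/
noncomputable def intVec {d : ℕ} (k : Fin d → ℤ) : Euc d :=
  WithLp.toLp 2 (fun i => (k i : ℝ))

/-- The unit cell `[0,1)^d`. -/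
def unitCell (d : ℕ) : Set (Euc d) := {x | ∀ i, x i ∈ Set.Ico (0 : ℝ) 1}

section Probability

variable {d : ℕ} {Ω : Type*} [MeasurableSpace Ω]

/-- The (continuum) gradient `∇Φ(x, ω)` in the space variable. For a Lipschitz field it is the
classical derivative at almost every `x`. -/
noncomputable def spaceGrad (Φ : Euc d → Ω → Euc d) (x : Euc d) (ω : Ω) : Euc d →L[ℝ] Euc d :=
  fderiv ℝ (fun y => Φ y ω) x

/-- The scalar `∂_l Φ(x, ω) · e_n`. -/
noncomputable def partialComp (Φ : Euc d → Ω → Euc d) (l n : Fin d) (x : Euc d) (ω : Ω) : ℝ :=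
  spaceGrad Φ x ω (basisVec l) n

/-- The mean increment `T_l = 𝔼[Φ(e_l) - Φ(0)]`. -/
noncomputable def meanIncrement (P : Measure Ω) (Φ : Euc d → Ω → Euc d) (l : Fin d) : Euc d :=
  ∫ ω, (Φ (basisVec l) ω - Φ 0 ω) ∂P

/-- `L²_0(Ω, ℝ^d)`: the square integrable random vectors with vanishing expectation. -/
noncomputable def L2zero (d : ℕ) (P : Measure Ω) [IsFiniteMeasure P] :
    Submodule ℝ (Lp (Euc d) 2 P) where
  carrier := {f | ∫ ω, f ω ∂P = 0}
  zero_mem' := by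
    have h : (∫ ω, (0 : Lp (Euc d) 2 P) ω ∂P) = ∫ _, (0 : Euc d) ∂P :=
      integral_congr_ae (Lp.coeFn_zero _ _ _)
    simpa using h
  add_mem' := by
    intro f g hf hg
    have hfi : Integrable f P := (Lp.memLp f).integrable (by norm_num)
    have hgi : Integrable g P := (Lp.memLp g).integrable (by norm_num)
    have h : (∫ ω, (f + g : Lp (Euc d) 2 P) ω ∂P) = ∫ ω, (f ω + g ω) ∂P :=
      integral_congr_ae (Lp.coeFn_add f g)
    have hf' : ∫ ω, f ω ∂P = 0 := hf
    have hg' : ∫ ω, g ω ∂P = 0 := hg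
    change (∫ ω, (f + g : Lp (Euc d) 2 P) ω ∂P) = 0
    rw [h, integral_add hfi hgi, hf', hg', add_zero]
  smul_mem' := by
    intro c f hf
    have h : (∫ ω, (c • f : Lp (Euc d) 2 P) ω ∂P) = ∫ ω, c • f ω ∂P :=
      integral_congr_ae (Lp.coeFn_smul c f)
    have hf' : ∫ ω, f ω ∂P = 0 := hf
    change (∫ ω, (c • f : Lp (Euc d) 2 P) ω ∂P) = 0
    rw [h, integral_smul, hf', smul_zero]

theorem L2zero_isClosed (P : Measure Ω) [IsFiniteMeasure P] :
    IsClosed (L2zero d P : Set (Lp (Euc d) 2 P)) := by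
  have hint : ∀ f : Lp (Euc d) 2 P, Integrable f P := fun f =>
    (Lp.memLp f).integrable (by norm_num)
  have hcont : Continuous (fun f : Lp (Euc d) 2 P => ∫ ω, f ω ∂P) := by
    have hc : ∀ a : ℝ≥0∞, a ≠ ∞ → Tendsto (fun t : ℝ≥0∞ => t * a) (𝓝 0) (𝓝 0) := by
      intro a ha
      simpa using ENNReal.Tendsto.mul_const (tendsto_id (α := ℝ≥0∞) (x := 𝓝 0)) (Or.inr ha)
    rw [continuous_iff_continuousAt]
    intro f
    refine tendsto_integral_of_L1' (μ := P) (fun ω => f ω) (hint f).aestronglyMeasurable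
      (Eventually.of_forall fun g => hint g) ?_
    have h2 : Tendsto (fun g : Lp (Euc d) 2 P => eLpNorm (⇑g - ⇑f) 2 P) (𝓝 f) (𝓝 0) :=
      (Lp.tendsto_Lp_iff_tendsto_eLpNorm' (fun g : Lp (Euc d) 2 P => g) f).1 tendsto_id
    have h3 := (hc (P Set.univ ^ (1 / (1 : ℝ≥0∞).toReal - 1 / (2 : ℝ≥0∞).toReal))
      (ENNReal.rpow_ne_top_of_nonneg (by norm_num) (measure_ne_top P _))).comp h2
    refine tendsto_of_tendsto_of_tendsto_of_le_of_le tendsto_const_nhds h3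
      (fun _ => zero_le) (fun g => ?_)
    exact eLpNorm_le_eLpNorm_mul_rpow_measure_univ (by norm_num)
      ((Lp.aestronglyMeasurable g).sub (Lp.aestronglyMeasurable f))
  exact isClosed_singleton.preimage hcont

instance (P : Measure Ω) [IsFiniteMeasure P] : CompleteSpace (L2zero d P) :=
  (L2zero_isClosed P).completeSpace_coe

end Probability

/-- `v` is `[0,1)^d`-periodic. -/
def CellPeriodic {d : ℕ} {F : Type*} (v : Euc d → F) : Prop :=
  ∀ (k : Fin d → ℤ) (x : Euc d), v (x + intVec k) = v x

/-- `g` is the weak derivative of `u` on `ℝ^d` in direction `e_l`. -/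
def IsWeakPartial {d : ℕ} {F : Type*} [NormedAddCommGroup F] [NormedSpace ℝ F]
    (l : Fin d) (u g : Euc d → F) : Prop :=
  ∀ φ : Euc d → ℝ, ContDiff ℝ ((⊤ : ℕ∞) : WithTop ℕ∞) φ → HasCompactSupport φ →
    ∫ x, (fderiv ℝ φ x (basisVec l)) • u x = -∫ x, φ x • g x

/-- `u ∈ W^{1,∞}_per([0,1)^d, F)` for a Banach space `F`: `u` is periodic, essentially bounded and
Bochner measurable, and so are its weak partial derivatives. -/
structure MemW1InfPer {d : ℕ} {F : Type*} [NormedAddCommGroup F] [NormedSpace ℝ F]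
    [CompleteSpace F] (u : Euc d → F) : Prop where
  periodic : CellPeriodic u
  memLp : MemLp u ∞ (volume.restrict (unitCell d))
  weakDeriv : ∀ l : Fin d, ∃ g : Euc d → F, CellPeriodic g ∧
    MemLp g ∞ (volume.restrict (unitCell d)) ∧ IsWeakPartial l u g

/-! Stationarity of `∇Φ` makes the increments of `Φ` stationary, so the defect `Φ(x + k, ω) - Φ(x,
θ_k ω)` does not depend on `x`. The corrector can therefore be sought constant in space, as one
random vector `W`. For a fixed base point `x`, put `c(k) = Φ(x + k) - Φ(x) - Tk`. This is a cocycle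
of the Koopman action on `L²`: `c(k + m) = c(m) + U_m c(k)`. If it is a coboundary, `c(k) = Y - U_k
Y`, then `W = -Y - Φ(x)` works, and centring `W` changes nothing.

To solve for `Y`, let `Y_N` be the mean of `c` over the box of side `N` and `A_N` the mean of the
`U_k` over it. Averaging the cocycle identity gives `c(m) + U_m Y_N = Y_N + A_N c(m)`. Averaging
again in `m` gives `Y_N - Y_{N'} = A_{N'} Y_N - A_N Y_{N'}`. Subadditivity bounds `A_N Y_{N'}` by `d
N' max_l ‖A_N c(e_l)‖`, so a rate `‖A_N c(e_l)‖ ≤ K N^(-δ)` with `δ > 1` makes the dyadic `Y_N`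
Cauchy, and the limit solves the equation (`exists_coboundary_of_boxAverage_decay`).

The rate comes from the covariance bound. The increment over `e_l` is an integral of `∂_l Φ` along a
unit segment, and averaging does not increase variance (`variance_integral_le`). Hence the box sum
has variance at most a double sum of covariances, of order `N^d N^(d-γ)` with `γ > 2`
(`exists_sum_latticeBox_decay_le`). Dividing by `N^(2d)` and taking a root gives `δ = γ / 2 > 1`. -/

/-! ### Lattice boxes and sums of decaying weights. -/

/-- The discrete box `{0, …, N-1}^d`. -/
noncomputable def latticeBox (d N : ℕ) : Finset (Fin d → ℤ) :=
  Fintype.piFinset fun _ => Finset.Ico (0 : ℤ) N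

theorem card_latticeBox (d N : ℕ) : (latticeBox d N).card = N ^ d := by
  simp [latticeBox, Fintype.card_piFinset]

theorem mem_latticeBox {d N : ℕ} {k : Fin d → ℤ} :
    k ∈ latticeBox d N ↔ ∀ i, 0 ≤ k i ∧ k i < N := by
  simp [latticeBox, Fintype.mem_piFinset]

theorem intVec_apply {d : ℕ} (k : Fin d → ℤ) (i : Fin d) : (intVec k : Euc d) i = k i := rfl

theorem intVec_add {d : ℕ} (k m : Fin d → ℤ) :
    (intVec (k + m) : Euc d) = intVec k + intVec m := by
  ext i; simp [intVec_apply]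

theorem intVec_neg {d : ℕ} (k : Fin d → ℤ) : (intVec (-k) : Euc d) = -intVec k := by
  ext i; simp [intVec_apply]

theorem intVec_single {d : ℕ} (l : Fin d) : (intVec (Pi.single l 1) : Euc d) = basisVec l := by
  ext i
  by_cases h : i = l
  · subst h; simp [intVec_apply, basisVec]
  · simp [intVec_apply, basisVec, h]

theorem abs_le_norm_intVec {d : ℕ} (k : Fin d → ℤ) (i : Fin d) :
    |(k i : ℝ)| ≤ ‖(intVec k : Euc d)‖ := by
  have := PiLp.norm_apply_le (intVec k : Euc d) i
  simpa [intVec_apply] using this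

/-- Induction on `N`: Bernoulli's inequality for the concave power `1 - β` bounds each term by the
corresponding increment of the right-hand side. -/
theorem sum_range_rpow_neg_le {β : ℝ} (h0 : 0 ≤ β) (h1 : β < 1) (N : ℕ) :
    ∑ j ∈ Finset.range N, (1 + (j : ℝ)) ^ (-β) ≤ (N : ℝ) ^ (1 - β) / (1 - β) := by
  have hγ : 0 < 1 - β := by linarith
  induction N with
  | zero => simp [Real.zero_rpow hγ.ne']
  | succ n ih =>
    rw [Finset.sum_range_succ]
    have hn : (0 : ℝ) < n + 1 := by positivity
    have hB := rpow_one_add_le_one_add_mul_self (s := -(1 / ((n : ℝ) + 1))) (p := 1 - β)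
      (by rw [neg_le_neg_iff, div_le_one hn]; linarith [n.cast_nonneg (α := ℝ)])
      hγ.le (by linarith)
    have h2 : (1 + -(1 / ((n : ℝ) + 1))) = n / (n + 1) := by field_simp; ring
    rw [h2, Real.div_rpow (by positivity) hn.le, div_le_iff₀ (by positivity)] at hB
    have h3 : ((n : ℝ) + 1) ^ (1 - β) = (n + 1) * (n + 1) ^ (-β) := by
      rw [sub_eq_add_neg, Real.rpow_add hn, Real.rpow_one]
    have h4 : (1 + (1 - β) * -(1 / ((n : ℝ) + 1))) * ((n : ℝ) + 1) ^ (1 - β)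
        = ((n : ℝ) + 1) ^ (1 - β) - (1 - β) * (n + 1) ^ (-β) := by
      rw [h3]; field_simp; ring
    rw [h4] at hB
    rw [le_div_iff₀ hγ] at ih ⊢
    push_cast
    rw [add_comm (1 : ℝ) n]
    nlinarith

/-- Each distance from `b` is attained by at most two integers, which reduces the sum to the
one-sided one. -/
theorem sum_Ico_rpow_neg_dist_le {β : ℝ} (h0 : 0 ≤ β) (h1 : β < 1) (N : ℕ) {b : ℤ}
    (hb : 0 ≤ b ∧ b < N) :
    ∑ a ∈ Finset.Ico (0 : ℤ) N, (1 + |((a - b : ℤ) : ℝ)|) ^ (-β)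
      ≤ 2 / (1 - β) * (N : ℝ) ^ (1 - β) := by
  classical
  have hmaps : ∀ a ∈ Finset.Ico (0 : ℤ) N, (a - b).natAbs ∈ Finset.range N := by
    intro a ha
    simp only [Finset.mem_Ico, Finset.mem_range] at *
    omega
  rw [← Finset.sum_fiberwise_of_maps_to hmaps]
  have hfib : ∀ j ∈ Finset.range N,
      ∑ a ∈ Finset.Ico (0 : ℤ) N with (a - b).natAbs = j, (1 + |((a - b : ℤ) : ℝ)|) ^ (-β)
        ≤ 2 * (1 + (j : ℝ)) ^ (-β) := by
    intro j _
    have hsub : (Finset.Ico (0 : ℤ) N).filter (fun a => (a - b).natAbs = j) ⊆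
        {b + j, b - j} := by
      intro a ha
      simp only [Finset.mem_filter, Finset.mem_insert, Finset.mem_singleton] at *
      omega
    have hcard := (Finset.card_le_card hsub).trans Finset.card_le_two
    rw [Finset.sum_congr rfl (g := fun _ => (1 + (j : ℝ)) ^ (-β)), Finset.sum_const,
      nsmul_eq_mul]
    · gcongr
      exact_mod_cast hcard
    · intro a ha
      have := (Finset.mem_filter.1 ha).2
      rw [← this, Nat.cast_natAbs]
      push_cast
      rfl
  calc _ ≤ ∑ j ∈ Finset.range N, 2 * (1 + (j : ℝ)) ^ (-β) := Finset.sum_le_sum hfib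
    _ = 2 * ∑ j ∈ Finset.range N, (1 + (j : ℝ)) ^ (-β) := by rw [Finset.mul_sum]
    _ ≤ 2 * ((N : ℝ) ^ (1 - β) / (1 - β)) := by
      gcongr; exact sum_range_rpow_neg_le h0 h1 N
    _ = _ := by ring

/-- A decay faster than `|k|^{-2}` on `ℤ^d`, `d ≥ 3`, sums over a box of side `N` to at most
`N^{d-γ}` with some `γ > 2`. -/
theorem exists_sum_latticeBox_decay_le {d : ℕ} (hd : 2 < d) {α : ℝ} (hα : 2 < α) :
    ∃ γ : ℝ, 2 < γ ∧ ∃ K : ℝ, 0 ≤ K ∧ ∀ N : ℕ, 0 < N → ∀ m ∈ latticeBox d N,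
      ∑ k ∈ latticeBox d N, 1 / (1 + ‖(intVec (k - m) : Euc d)‖ ^ α)
        ≤ K * (N : ℝ) ^ ((d : ℝ) - γ) := by
  have hd3 : (3 : ℝ) ≤ d := by exact_mod_cast hd
  have hd0 : (0 : ℝ) < d := by linarith
  -- The cap `5 / 2 < 3 ≤ d` keeps `β = γ / d` below `1`, as the one-dimensional sums require, while
  -- `γ` stays above `2`.
  set γ : ℝ := min α (5 / 2) with hγ
  have hγ2 : 2 < γ := lt_min hα (by norm_num)
  have hγα : γ ≤ α := min_le_left _ _
  have hγ5 : γ ≤ 5 / 2 := min_le_right _ _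
  set β : ℝ := γ / d with hβ
  have hβ0 : 0 ≤ β := by positivity
  have hβ1 : β < 1 := by rw [hβ, div_lt_one hd0]; linarith
  have hβd : β * d = γ := by rw [hβ]; field_simp
  refine ⟨γ, hγ2, 2 ^ γ * (2 / (1 - β)) ^ d,
    by have : 0 < 1 - β := by linarith
       positivity, fun N hN m hm => ?_⟩
  have hterm : ∀ k : Fin d → ℤ, 1 / (1 + ‖(intVec (k - m) : Euc d)‖ ^ α)
      ≤ 2 ^ γ * ∏ i, (1 + |((k i - m i : ℤ) : ℝ)|) ^ (-β) := by
    intro k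
    set r := ‖(intVec (k - m) : Euc d)‖ with hr
    have hr0 : 0 ≤ r := norm_nonneg _
    have hcoord : ∀ i, |((k i - m i : ℤ) : ℝ)| ≤ r := fun i => by
      simpa using abs_le_norm_intVec (k - m) i
    -- The power is split into `d` equal factors, each bounded through one coordinate, so that the
    -- sum over the box factorises.
    have h1 : (1 + r) ^ (-γ) ≤ ∏ i, (1 + |((k i - m i : ℤ) : ℝ)|) ^ (-β) := by
      calc (1 + r) ^ (-γ) = ∏ _i : Fin d, (1 + r) ^ (-β) := by
            rw [Finset.prod_const, Finset.card_univ, Fintype.card_fin, ← Real.rpow_natCast,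
              ← Real.rpow_mul (by positivity), neg_mul, hβd]
        _ ≤ _ := by
            refine Finset.prod_le_prod (fun _ _ => by positivity) fun i _ => ?_
            exact Real.rpow_le_rpow_of_nonpos (by positivity) (by linarith [hcoord i])
              (by linarith)
    have h2 : (1 + r) ^ γ ≤ 2 ^ γ * (1 + r ^ α) := by
      have hra : 0 ≤ r ^ α := by positivity
      by_cases hk : r ≤ 1
      · calc (1 + r) ^ γ ≤ 2 ^ γ :=
            Real.rpow_le_rpow (by positivity) (by linarith) (by linarith)
          _ ≤ 2 ^ γ * (1 + r ^ α) := le_mul_of_one_le_right (by positivity) (by linarith)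
      · push Not at hk
        calc (1 + r) ^ γ ≤ (2 * r) ^ γ :=
            Real.rpow_le_rpow (by positivity) (by linarith) (by linarith)
          _ = 2 ^ γ * r ^ γ := Real.mul_rpow (by norm_num) hr0
          _ ≤ 2 ^ γ * (1 + r ^ α) := by
            gcongr
            linarith [Real.rpow_le_rpow_of_exponent_le hk.le hγα]
    refine le_trans ?_ (mul_le_mul_of_nonneg_left h1 (by positivity))
    rw [Real.rpow_neg (by positivity), ← div_eq_mul_inv, div_le_div_iff₀ (by positivity)
      (by positivity)]
    linarith
  have hprod : ∑ k ∈ latticeBox d N, ∏ i, (1 + |((k i - m i : ℤ) : ℝ)|) ^ (-β)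
      = ∏ i, ∑ a ∈ Finset.Ico (0 : ℤ) N, (1 + |((a - m i : ℤ) : ℝ)|) ^ (-β) := by
    rw [latticeBox, Finset.prod_univ_sum]
  calc _ ≤ ∑ k ∈ latticeBox d N, 2 ^ γ * ∏ i, (1 + |((k i - m i : ℤ) : ℝ)|) ^ (-β) :=
        Finset.sum_le_sum fun k _ => hterm k
    _ = 2 ^ γ * ∏ i, ∑ a ∈ Finset.Ico (0 : ℤ) N, (1 + |((a - m i : ℤ) : ℝ)|) ^ (-β) := by
        rw [← Finset.mul_sum, hprod]
    _ ≤ 2 ^ γ * ∏ _i : Fin d, (2 / (1 - β) * (N : ℝ) ^ (1 - β)) := by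
        gcongr with i
        exact sum_Ico_rpow_neg_dist_le hβ0 hβ1 N (mem_latticeBox.1 hm i)
    _ = 2 ^ γ * (2 / (1 - β)) ^ d * (N : ℝ) ^ ((d : ℝ) - γ) := by
        rw [Finset.prod_const, Finset.card_univ, Fintype.card_fin, mul_pow,
          ← Real.rpow_natCast (_ ^ _), ← Real.rpow_mul (by positivity), sub_mul, one_mul, hβd]
        ring

/-! ### Cocycles of isometric `ℤ^d`-actions and their coboundaries. -/

section Cocycle

variable {d : ℕ} {H : Type*} [NormedAddCommGroup H] [NormedSpace ℝ H]

/-- Averages of the isometries `U k` over the boxes of side `N`. -/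
noncomputable def boxAverage (U : (Fin d → ℤ) → H →ₗᵢ[ℝ] H) (N : ℕ) (v : H) : H :=
  ((N : ℝ) ^ d)⁻¹ • ∑ k ∈ latticeBox d N, U k v

theorem boxAverage_add (U : (Fin d → ℤ) → H →ₗᵢ[ℝ] H) (N : ℕ) (v w : H) :
    boxAverage U N (v + w) = boxAverage U N v + boxAverage U N w := by
  simp [boxAverage, Finset.sum_add_distrib]

theorem boxAverage_smul (U : (Fin d → ℤ) → H →ₗᵢ[ℝ] H) (N : ℕ) (a : ℝ) (v : H) :
    boxAverage U N (a • v) = a • boxAverage U N v := by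
  simp only [boxAverage, map_smul, ← Finset.smul_sum]
  rw [smul_comm]

theorem boxAverage_sum (U : (Fin d → ℤ) → H →ₗᵢ[ℝ] H) (N : ℕ) {ι : Type*} (s : Finset ι)
    (v : ι → H) : boxAverage U N (∑ i ∈ s, v i) = ∑ i ∈ s, boxAverage U N (v i) := by
  simp only [boxAverage, map_sum, ← Finset.smul_sum]
  rw [Finset.sum_comm]

theorem boxAverage_neg (U : (Fin d → ℤ) → H →ₗᵢ[ℝ] H) (N : ℕ) (v : H) :
    boxAverage U N (-v) = -boxAverage U N v := by
  simp [boxAverage]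

theorem boxAverage_comm {U : (Fin d → ℤ) → H →ₗᵢ[ℝ] H}
    (hU : ∀ k m v, U (k + m) v = U k (U m v)) (N : ℕ) (m : Fin d → ℤ) (v : H) :
    boxAverage U N (U m v) = U m (boxAverage U N v) := by
  simp only [boxAverage, map_smul, map_sum, ← hU, add_comm m]

/-- The averages of a cocycle over the boxes of side `N`. -/
noncomputable def cocycleAverage (c : (Fin d → ℤ) → H) (N : ℕ) : H :=
  ((N : ℝ) ^ d)⁻¹ • ∑ k ∈ latticeBox d N, c k

theorem inv_smul_sum_latticeBox_const {N : ℕ} (hN : 0 < N) (v : H) :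
    ((N : ℝ) ^ d)⁻¹ • ∑ _k ∈ latticeBox d N, v = v := by
  rw [Finset.sum_const, card_latticeBox, ← Nat.cast_smul_eq_nsmul ℝ, smul_smul, Nat.cast_pow,
    inv_mul_cancel₀ (by positivity), one_smul]

/-- Both sides are the average of `c (k + m)` over `k` in the box, expanded by the cocycle identity
in its two orders. `cocycleAverage c N` thus solves the coboundary equation up to the error
`boxAverage U N (c m)`. -/
theorem cocycle_add_cocycleAverage {U : (Fin d → ℤ) → H →ₗᵢ[ℝ] H} {c : (Fin d → ℤ) → H}
    (hc : ∀ k m, c (k + m) = c m + U m (c k)) {N : ℕ} (hN : 0 < N) (m : Fin d → ℤ) :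
    c m + U m (cocycleAverage c N) = cocycleAverage c N + boxAverage U N (c m) := by
  have h1 : ((N : ℝ) ^ d)⁻¹ • ∑ k ∈ latticeBox d N, c (k + m)
      = c m + U m (cocycleAverage c N) := by
    simp only [hc _ m, Finset.sum_add_distrib, smul_add, inv_smul_sum_latticeBox_const hN,
      cocycleAverage, map_smul, map_sum]
  have h2 : ((N : ℝ) ^ d)⁻¹ • ∑ k ∈ latticeBox d N, c (k + m)
      = cocycleAverage c N + boxAverage U N (c m) := by
    simp only [add_comm _ m, hc m, Finset.sum_add_distrib, smul_add, boxAverage, cocycleAverage]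
  rw [← h1, h2]

/-- Averaging the approximate coboundary equation over the second box expresses the difference of
two approximate solutions through averages that decay. -/
theorem cocycleAverage_add_boxAverage {U : (Fin d → ℤ) → H →ₗᵢ[ℝ] H} {c : (Fin d → ℤ) → H}
    (hc : ∀ k m, c (k + m) = c m + U m (c k)) {N N' : ℕ} (hN : 0 < N) (hN' : 0 < N') :
    cocycleAverage c N' + boxAverage U N' (cocycleAverage c N)
      = cocycleAverage c N + boxAverage U N (cocycleAverage c N') := by
  have h : ((N' : ℝ) ^ d)⁻¹ • ∑ m ∈ latticeBox d N', (c m + U m (cocycleAverage c N))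
      = ((N' : ℝ) ^ d)⁻¹ • ∑ m ∈ latticeBox d N',
        (cocycleAverage c N + boxAverage U N (c m)) := by
    congr 1
    exact Finset.sum_congr rfl fun m _ => cocycle_add_cocycleAverage hc hN m
  rw [Finset.sum_add_distrib, Finset.sum_add_distrib, smul_add, smul_add,
    inv_smul_sum_latticeBox_const hN', ← boxAverage_sum, ← boxAverage_smul] at h
  exact h

/-- Box averages commute with the isometries, so `m ↦ ‖boxAverage U N (c m)‖` is subadditive and
even. It therefore grows at most like the `ℓ¹` norm of `m`. -/
theorem norm_boxAverage_cocycle_le {U : (Fin d → ℤ) → H →ₗᵢ[ℝ] H} {c : (Fin d → ℤ) → H}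
    (hU : ∀ k m v, U (k + m) v = U k (U m v))
    (hc : ∀ k m, c (k + m) = c m + U m (c k)) {N : ℕ} {B : ℝ}
    (hB : ∀ l, ‖boxAverage U N (c (Pi.single l 1))‖ ≤ B) (m : Fin d → ℤ) :
    ‖boxAverage U N (c m)‖ ≤ (∑ i, |(m i : ℝ)|) * B := by
  classical
  set ν : (Fin d → ℤ) → ℝ := fun m => ‖boxAverage U N (c m)‖ with hν
  have hsub : ∀ k m, ν (k + m) ≤ ν k + ν m := by
    intro k m
    simp only [hν, hc k m, boxAverage_add, boxAverage_comm hU]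
    refine (norm_add_le _ _).trans ?_
    rw [LinearIsometry.norm_map, add_comm]
  have hc0 : c 0 = 0 := by
    have := hc 0 0
    rw [add_zero, left_eq_add] at this
    rw [← norm_eq_zero, ← (U 0).norm_map, this, norm_zero]
  have hν0 : ν 0 = 0 := by simp [hν, hc0, boxAverage]
  have hneg : ∀ m, ν (-m) = ν m := by
    intro m
    have h := hc (-m) m
    rw [neg_add_cancel, hc0] at h
    have h2 : U m (c (-m)) = -c m := (neg_eq_of_add_eq_zero_right h.symm).symm
    simp only [hν]
    rw [← (U m).norm_map, ← boxAverage_comm hU, h2, boxAverage_neg, norm_neg]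
  have hnat : ∀ l (n : ℕ), ν (Pi.single l (n : ℤ)) ≤ n * B := by
    intro l n
    induction n with
    | zero => simp [hν0]
    | succ n ih =>
      have : (Pi.single l ((n + 1 : ℕ) : ℤ) : Fin d → ℤ)
          = Pi.single l (n : ℤ) + Pi.single l 1 := by
        rw [← Pi.single_add]; push_cast; rfl
      rw [this]
      refine (hsub _ _).trans ?_
      have := hB l
      push_cast
      simp only [hν] at ih ⊢
      linarith
  have hint : ∀ l (z : ℤ), ν (Pi.single l z) ≤ |(z : ℝ)| * B := by
    intro l z
    obtain ⟨n, rfl | rfl⟩ := z.eq_nat_or_neg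
    · simpa using hnat l n
    · rw [Pi.single_neg, hneg]
      simpa using hnat l n
  calc ν m = ν (∑ i, Pi.single i (m i)) := by rw [Finset.univ_sum_single]
    _ ≤ ∑ i, ν (Pi.single i (m i)) := Finset.le_sum_of_subadditive ν hν0.le hsub _ _
    _ ≤ ∑ i, |(m i : ℝ)| * B := Finset.sum_le_sum fun i _ => hint i _
    _ = _ := by rw [Finset.sum_mul]

theorem norm_boxAverage_cocycleAverage_le {U : (Fin d → ℤ) → H →ₗᵢ[ℝ] H} {c : (Fin d → ℤ) → H}
    (hU : ∀ k m v, U (k + m) v = U k (U m v))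
    (hc : ∀ k m, c (k + m) = c m + U m (c k)) {N N' : ℕ} (hN' : 0 < N') {B : ℝ} (hB0 : 0 ≤ B)
    (hB : ∀ l, ‖boxAverage U N (c (Pi.single l 1))‖ ≤ B) :
    ‖boxAverage U N (cocycleAverage c N')‖ ≤ d * N' * B := by
  rw [cocycleAverage, boxAverage_smul, boxAverage_sum, norm_smul, norm_inv, norm_pow,
    Real.norm_natCast, inv_mul_le_iff₀ (by positivity)]
  calc _ ≤ ∑ k ∈ latticeBox d N', ‖boxAverage U N (c k)‖ := norm_sum_le _ _
    _ ≤ ∑ k ∈ latticeBox d N', (d * N' * B) := by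
      refine Finset.sum_le_sum fun k hk => (norm_boxAverage_cocycle_le hU hc hB k).trans ?_
      gcongr
      calc ∑ i, |(k i : ℝ)| ≤ ∑ _i : Fin d, (N' : ℝ) := by
            refine Finset.sum_le_sum fun i _ => ?_
            have := mem_latticeBox.1 hk i
            rw [abs_of_nonneg (by exact_mod_cast this.1)]
            exact_mod_cast this.2.le
        _ = _ := by simp
    _ = _ := by rw [Finset.sum_const, card_latticeBox]; simp

/-- A cocycle of an isometric `ℤ^d`-action whose increments have box averages decaying faster than
the inverse of the side length is a coboundary. -/
theorem exists_coboundary_of_boxAverage_decay [CompleteSpace H]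
    {U : (Fin d → ℤ) → H →ₗᵢ[ℝ] H} {c : (Fin d → ℤ) → H}
    (hU : ∀ k m v, U (k + m) v = U k (U m v))
    (hc : ∀ k m, c (k + m) = c m + U m (c k)) {γ K : ℝ} (hγ : 1 < γ) (hK : 0 ≤ K)
    (hdecay : ∀ l (N : ℕ), 0 < N → ‖boxAverage U N (c (Pi.single l 1))‖ ≤ K * (N : ℝ) ^ (-γ)) :
    ∃ Y : H, ∀ m, c m = Y - U m Y := by
  -- Along dyadic sides `N' = 2N`, the factor `N'` lost by subadditivity is comparable to `N`, so
  -- consecutive differences are of order `N ^ (1 - γ)`, which is geometric in `j`.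
  set Y : ℕ → H := fun j => cocycleAverage c (2 ^ j) with hY
  have hpos : ∀ j : ℕ, 0 < 2 ^ j := fun j => by positivity
  set r : ℝ := 2 ^ (1 - γ) with hr
  have hr1 : r < 1 := Real.rpow_lt_one_of_one_lt_of_neg (by norm_num) (by linarith)
  have hr0 : 0 ≤ r := by positivity
  have hpow : ∀ j : ℕ, ((2 ^ j : ℕ) : ℝ) ^ (-γ) * 2 ^ j = r ^ j := by
    intro j
    rw [hr, ← Real.rpow_natCast, ← Real.rpow_natCast, ← Real.rpow_mul (by norm_num)]
    push_cast
    rw [← Real.rpow_natCast, ← Real.rpow_mul (by norm_num), ← Real.rpow_add (by norm_num)]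
    ring_nf
  have hdist : ∀ j, dist (Y j) (Y (j + 1)) ≤ (4 * d * K) * r ^ j := by
    intro j
    have h := cocycleAverage_add_boxAverage hc (hpos j) (hpos (j + 1))
    have h' : Y j - Y (j + 1) = boxAverage U (2 ^ (j + 1)) (Y j)
        - boxAverage U (2 ^ j) (Y (j + 1)) := by
      rw [sub_eq_sub_iff_add_eq_add, add_comm (boxAverage _ _ _), hY]; exact h.symm
    rw [dist_eq_norm, h']
    have hp : (0 : ℝ) ≤ ((2 ^ j : ℕ) : ℝ) ^ (-γ) := by positivity
    have h1 := norm_boxAverage_cocycleAverage_le (N' := 2 ^ (j + 1)) hU hc (hpos _)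
      (by positivity) (fun l => hdecay l (2 ^ j) (hpos j))
    have h2 := norm_boxAverage_cocycleAverage_le (N' := 2 ^ j) hU hc (hpos _)
      (by positivity) (fun l => hdecay l (2 ^ (j + 1)) (hpos _))
    have h3 : ((2 ^ (j + 1) : ℕ) : ℝ) ^ (-γ) ≤ ((2 ^ j : ℕ) : ℝ) ^ (-γ) := by
      apply Real.rpow_le_rpow_of_nonpos (by positivity) _ (by linarith)
      exact_mod_cast Nat.pow_le_pow_right (by norm_num) (Nat.le_succ j)
    have h4 : (d : ℝ) * (2 ^ j : ℕ) * (K * ((2 ^ (j + 1) : ℕ) : ℝ) ^ (-γ)) ≤ d * K * r ^ j := by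
      rw [← hpow j]
      calc _ ≤ (d : ℝ) * (2 ^ j : ℕ) * (K * ((2 ^ j : ℕ) : ℝ) ^ (-γ)) := by gcongr
        _ = _ := by push_cast; ring
    have h5 : (d : ℝ) * (2 ^ (j + 1) : ℕ) * (K * ((2 ^ j : ℕ) : ℝ) ^ (-γ))
        = 2 * (d * K * r ^ j) := by
      rw [← hpow j]; push_cast; ring
    have h6 : 0 ≤ d * K * r ^ j := by positivity
    calc _ ≤ ‖boxAverage U (2 ^ (j + 1)) (Y j)‖ + ‖boxAverage U (2 ^ j) (Y (j + 1))‖ :=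
          norm_sub_le _ _
      _ ≤ d * K * r ^ j + 2 * (d * K * r ^ j) := add_le_add (h2.trans h4) (h1.trans h5.le)
      _ ≤ _ := by linarith
  obtain ⟨Z, hZ⟩ := cauchySeq_tendsto_of_complete (cauchySeq_of_le_geometric _ _ hr1 hdist)
  refine ⟨Z, fun m => ?_⟩
  have hsmall : Tendsto (fun j => boxAverage U (2 ^ j) (c m)) atTop (𝓝 0) := by
    have hg : Tendsto (fun j : ℕ => (∑ i, |(m i : ℝ)|) * (K * r ^ j)) atTop (𝓝 0) := by
      simpa using ((tendsto_pow_atTop_nhds_zero_of_lt_one hr0 hr1).const_mul K).const_mul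
        (∑ i, |(m i : ℝ)|)
    refine squeeze_zero_norm (fun j => ?_) hg
    refine norm_boxAverage_cocycle_le hU hc (fun l => (hdecay l _ (hpos j)).trans ?_) m
    rw [← hpow j]
    gcongr
    exact le_mul_of_one_le_right (by positivity) (one_le_pow₀ (by norm_num))
  have hl : Tendsto (fun j => c m + U m (Y j)) atTop (𝓝 (c m + U m Z)) :=
    (((U m).continuous.tendsto Z).comp hZ).const_add _
  have hr' : Tendsto (fun j => c m + U m (Y j)) atTop (𝓝 (Z + 0)) := by
    refine (hZ.add hsmall).congr fun j => ?_
    exact (cocycle_add_cocycleAverage hc (hpos j) m).symm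
  have := tendsto_nhds_unique hl hr'
  rw [add_zero] at this
  exact eq_sub_of_add_eq this

end Cocycle

/-! ### Joint measurability of the derivative of a random field. -/

section JointMeasurability

variable {Ω E F : Type*} [MeasurableSpace Ω]

/-- A process with continuous paths is a random variable in the space of continuous functions. -/
theorem measurable_mk_continuousMap [TopologicalSpace E] [SecondCountableTopology E]
    [LocallyCompactSpace E] [PseudoEMetricSpace F] [SecondCountableTopology F]
    [MeasurableSpace F] [BorelSpace F] {u : E → Ω → F}
    (hcont : ∀ ω, Continuous fun x => u x ω) (hmeas : ∀ x, Measurable (u x)) :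
    @Measurable Ω C(E, F) _ (borel _) fun ω => ⟨fun x => u x ω, hcont ω⟩ := by
  have hb := borel_eq_generateFrom_of_subbasis (ContinuousMap.compactOpen_eq (X := E) (Y := F))
  rw [hb]
  refine measurable_generateFrom ?_
  rintro _ ⟨K, hK, U, hU, rfl⟩
  have hU' : IsOpen U := hU
  have hK' : IsCompact K := hK
  obtain ⟨S, hSc, hSd⟩ := TopologicalSpace.exists_countable_dense K
  -- Sets of maps sending a compact `K` into an open `U` form a subbasis. By compactness the image
  -- keeps a positive distance from `Uᶜ`; by continuity a given margin need only be tested on a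
  -- countable dense subset of `K`.
  have hset : ((fun ω => (⟨fun x => u x ω, hcont ω⟩ : C(E, F))) ⁻¹' {f | Set.MapsTo f K U})
      = ⋃ n : ℕ, ⋂ s ∈ S, {ω | ((n : ℝ≥0∞) + 1)⁻¹ ≤ Metric.infEDist (u s ω) Uᶜ} := by
    ext ω
    simp only [Set.mem_preimage, Set.mem_ofPred_eq, Set.mem_iUnion, Set.mem_iInter]
    constructor
    · intro h
      have hc : IsCompact ((fun x => u x ω) '' K) := hK'.image (hcont ω)
      obtain ⟨δ, hδ, hsub⟩ := hc.exists_thickening_subset_open hU' (Set.mapsTo_iff_image_subset.1 h)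
      obtain ⟨n, hn⟩ := ENNReal.exists_inv_nat_lt (ENNReal.ofReal_pos.2 hδ).ne'
      refine ⟨n, fun s _ => ?_⟩
      refine le_trans (le_trans ?_ hn.le) ?_
      · exact ENNReal.inv_le_inv.2 le_self_add
      · rw [Metric.le_infEDist]
        intro y hy
        by_contra! hlt
        refine hy (hsub ?_)
        rw [Metric.mem_thickening_iff_infEDist_lt]
        refine lt_of_le_of_lt (Metric.infEDist_le_edist_of_mem
          (Set.mem_image_of_mem _ s.2)) ?_
        rwa [edist_comm]
    · rintro ⟨n, hn⟩ x hx
      by_contra hxU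
      have hcl : IsClosed {y : K | ((n : ℝ≥0∞) + 1)⁻¹ ≤ Metric.infEDist (u y ω) Uᶜ} :=
        isClosed_le continuous_const
          (Metric.continuous_infEDist.comp ((hcont ω).comp continuous_subtype_val))
      have hx' := hcl.closure_subset_iff.2 (fun s hs => hn s hs) (hSd ⟨x, hx⟩)
      have h0 : Metric.infEDist (u x ω) Uᶜ = 0 := Metric.infEDist_zero_of_mem hxU
      simp only [Set.mem_ofPred_eq, h0, nonpos_iff_eq_zero, ENNReal.inv_eq_zero] at hx'
      exact absurd hx' (by finiteness)
  rw [hset]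
  refine MeasurableSet.iUnion fun n => MeasurableSet.biInter hSc fun s _ => ?_
  exact measurableSet_le measurable_const (measurable_infEDist.comp (hmeas s))

variable [NormedAddCommGroup E] [NormedSpace ℝ E] [FiniteDimensional ℝ E]
  [MeasurableSpace E] [BorelSpace E]
  [NormedAddCommGroup F] [NormedSpace ℝ F] [FiniteDimensional ℝ F]
  [MeasurableSpace F] [BorelSpace F]
  {u : E → Ω → F}

/-- Measurability of differentiability with a parameter requires a topological parameter space. Here
the parameter is the path itself in `C(E, F)`, on which evaluation is jointly continuous. -/
theorem measurableSet_differentiableAt_process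
    (hcont : ∀ ω, Continuous fun x => u x ω) (hmeas : ∀ x, Measurable (u x)) :
    MeasurableSet {p : E × Ω | DifferentiableAt ℝ (fun y => u y p.2) p.1} := by
  have : ProperSpace E := FiniteDimensional.proper ℝ E
  have : ProperSpace F := FiniteDimensional.proper ℝ F
  let _ : MeasurableSpace C(E, F) := borel _
  have : BorelSpace C(E, F) := ⟨rfl⟩
  have h := measurableSet_of_differentiableAt_with_param (𝕜 := ℝ) (α := C(E, F)) (E := E)
    (F := F) (f := fun g x => g x) continuous_eval
  have hm : Measurable fun p : E × Ω =>
      ((⟨fun x => u x p.2, hcont p.2⟩ : C(E, F)), p.1) :=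
    ((measurable_mk_continuousMap hcont hmeas).comp measurable_snd).prodMk measurable_fst
  exact hm h

theorem measurable_fderiv_process
    (hcont : ∀ ω, Continuous fun x => u x ω) (hmeas : ∀ x, Measurable (u x)) :
    Measurable fun p : E × Ω => fderiv ℝ (fun y => u y p.2) p.1 := by
  have : ProperSpace E := FiniteDimensional.proper ℝ E
  have : ProperSpace F := FiniteDimensional.proper ℝ F
  let _ : MeasurableSpace C(E, F) := borel _
  have : BorelSpace C(E, F) := ⟨rfl⟩
  have h := measurable_fderiv_with_param (𝕜 := ℝ) (α := C(E, F)) (E := E)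
    (F := F) (f := fun g x => g x) continuous_eval
  have hm : Measurable fun p : E × Ω =>
      ((⟨fun x => u x p.2, hcont p.2⟩ : C(E, F)), p.1) :=
    ((measurable_mk_continuousMap hcont hmeas).comp measurable_snd).prodMk measurable_fst
  exact h.comp hm

end JointMeasurability

/-! ### Lipschitz functions controlled by their almost everywhere gradient. -/

section Lipschitz

/-- A Lipschitz function on a segment is absolutely continuous, so the fundamental theorem of
calculus applies; the functional `L` reduces it to the scalar case. -/
theorem LipschitzWith.integral_fderiv_line_eq_sub {E F : Type*} [NormedAddCommGroup E]
    [NormedSpace ℝ E] [NormedAddCommGroup F] [NormedSpace ℝ F] {u : E → F} {K : ℝ≥0}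
    (hu : LipschitzWith K u) {x v : E} (hdiff : ∀ᵐ t : ℝ, DifferentiableAt ℝ u (x + t • v))
    (L : F →L[ℝ] ℝ) :
    ∫ t in (0 : ℝ)..1, L (fderiv ℝ u (x + t • v) v) = L (u (x + v)) - L (u x) := by
  set g : ℝ → ℝ := fun t => L (u (x + t • v)) with hg
  have hline : LipschitzWith ‖v‖₊ fun t : ℝ => x + t • v := by
    refine LipschitzWith.of_dist_le_mul fun s t => ?_
    rw [dist_add_left, dist_eq_norm, ← sub_smul, norm_smul, mul_comm, dist_eq_norm]
    simp
  have hgL : LipschitzWith (‖L‖₊ * (K * ‖v‖₊)) g := L.lipschitz.comp (hu.comp hline)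
  have hac := (hgL.lipschitzOnWith (s := Set.uIcc 0 1)).absolutelyContinuousOnInterval
  have h := hac.integral_deriv_eq_sub
  have hcongr : ∫ t in (0 : ℝ)..1, L (fderiv ℝ u (x + t • v) v) = ∫ t in (0 : ℝ)..1, deriv g t := by
    refine intervalIntegral.integral_congr_ae ?_
    filter_upwards [hdiff] with t ht _
    have hl : HasDerivAt (fun t : ℝ => x + t • v) v t := by
      simpa using ((hasDerivAt_id t).smul_const v).const_add x
    exact ((L.hasFDerivAt.comp_hasDerivAt t (ht.hasFDerivAt.comp_hasDerivAt t hl)).deriv).symm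
  rw [hcongr, h]
  simp [hg]

variable {E F : Type*} [NormedAddCommGroup E] [NormedSpace ℝ E] [FiniteDimensional ℝ E]
  [MeasurableSpace E] [BorelSpace E] {μ : Measure E} [μ.IsAddHaarMeasure]
  [NormedAddCommGroup F] [NormedSpace ℝ F] [FiniteDimensional ℝ F]

/-- An almost everywhere property holds almost everywhere on almost every line of direction `v`. -/
theorem ae_ae_line_of_ae {p : E → Prop} (h : ∀ᵐ x ∂μ, p x) (v : E) :
    ∀ᵐ x ∂μ, ∀ᵐ t : ℝ, p (x + t • v) := by
  obtain ⟨s, hs, hsm, hs0⟩ := exists_measurable_superset_of_null (ae_iff.1 h)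
  have hmem : ∀ᵐ x ∂μ, x ∈ sᶜ := by
    rw [ae_iff]; simpa using hs0
  have := (ae_ae_add_linearMap_mem_iff (LinearMap.toSpanSingleton ℝ E v) volume μ
    hsm.compl).2 hmem
  filter_upwards [this] with x hx
  filter_upwards [hx] with t ht
  by_contra hp
  exact ht (hs hp)

/-- A Lipschitz function whose gradient is bounded by `M` almost everywhere is `M`-Lipschitz. -/
theorem LipschitzWith.norm_sub_le_of_ae_norm_fderiv_le {u : E → F} {K : ℝ≥0}
    (hu : LipschitzWith K u) {M : ℝ} (hM : ∀ᵐ x ∂μ, ‖fderiv ℝ u x‖ ≤ M) (x y : E) :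
    ‖u y - u x‖ ≤ M * ‖y - x‖ := by
  set v := y - x with hv
  have hae : ∀ᵐ z ∂μ, ‖u (z + v) - u z‖ ≤ M * ‖v‖ := by
    filter_upwards [ae_ae_line_of_ae (hu.ae_differentiableAt (μ := μ)) v,
      ae_ae_line_of_ae hM v] with z hz hzM
    by_cases hzero : u (z + v) - u z = 0
    · rw [hzero, norm_zero]
      obtain ⟨t, ht⟩ := hzM.exists
      -- The sign of `M` is not assumed; it follows from the gradient bound at any one point.
      exact mul_nonneg ((norm_nonneg _).trans ht) (norm_nonneg _)
    obtain ⟨L, hL1, hL⟩ := exists_dual_vector ℝ (u (z + v) - u z) (norm_ne_zero_iff.2 hzero)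
    have hint := hu.integral_fderiv_line_eq_sub hz L
    have hL' : L (u (z + v)) - L (u z) = ‖u (z + v) - u z‖ := by
      rw [← map_sub, hL]; rfl
    rw [← hL', ← hint]
    refine (le_abs_self _).trans ?_
    have := intervalIntegral.norm_integral_le_of_norm_le_const_ae (a := (0 : ℝ)) (b := 1)
      (f := fun t => L (fderiv ℝ u (z + t • v) v)) (C := M * ‖v‖) (by
        filter_upwards [hzM] with t ht _
        calc ‖L (fderiv ℝ u (z + t • v) v)‖ ≤ ‖L‖ * ‖fderiv ℝ u (z + t • v) v‖ := L.le_opNorm _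
          _ ≤ 1 * (‖fderiv ℝ u (z + t • v)‖ * ‖v‖) := by
            rw [hL1]; gcongr; exact ContinuousLinearMap.le_opNorm _ _
          _ ≤ M * ‖v‖ := by rw [one_mul]; gcongr)
    simpa using this
  -- The bound is so far known for almost every base point; it is a closed condition, so density
  -- gives every base point.
  have hdense := Measure.dense_of_ae hae
  have hcl : IsClosed {z | ‖u (z + v) - u z‖ ≤ M * ‖v‖} :=
    isClosed_le (by have := hu.continuous; fun_prop) continuous_const
  have := hcl.closure_subset_iff.2 subset_rfl (hdense x)
  simpa [hv] using this

end Lipschitz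

/-! ### Variance and covariance. -/

/-- Averaging a family of random variables does not increase the variance. -/
theorem variance_integral_le {T Ω : Type*} [MeasurableSpace T] [MeasurableSpace Ω]
    {ν : Measure T} [IsProbabilityMeasure ν] {P : Measure Ω} [IsProbabilityMeasure P]
    {G : T → Ω → ℝ} (hG : Measurable (Function.uncurry G)) {B V : ℝ}
    (hB : ∀ᵐ t ∂ν, ∀ᵐ ω ∂P, |G t ω| ≤ B) (hV : ∀ᵐ t ∂ν, Var[G t; P] ≤ V) :
    Var[fun ω => ∫ t, G t ω ∂ν; P] ≤ V := by
  have hBprod : ∀ᵐ p ∂ν.prod P, ‖Function.uncurry G p‖ ≤ B := by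
    rw [Measure.ae_prod_iff_ae_ae (measurableSet_le hG.norm measurable_const)]
    exact hB
  have hGi : Integrable (Function.uncurry G) (ν.prod P) :=
    Integrable.of_bound hG.aestronglyMeasurable B hBprod
  set m : T → ℝ := fun t => ∫ ω, G t ω ∂P with hm
  have hmm : Measurable m := (hG.stronglyMeasurable.integral_prod_right).measurable
  have hmB : ∀ᵐ t ∂ν, |m t| ≤ B := by
    filter_upwards [hB] with t ht
    simpa using norm_integral_le_of_norm_le_const (μ := P) (f := G t) (C := B) ht
  set H : T → Ω → ℝ := fun t ω => G t ω - m t with hH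
  have hHm : Measurable (Function.uncurry H) := hG.sub (hmm.comp measurable_fst)
  have hHB : ∀ᵐ p ∂ν.prod P, ‖Function.uncurry H p‖ ≤ 2 * B := by
    rw [Measure.ae_prod_iff_ae_ae (measurableSet_le hHm.norm measurable_const)]
    filter_upwards [hB, hmB] with t ht htm
    filter_upwards [ht] with ω hω
    calc |G t ω - m t| ≤ |G t ω| + |m t| := abs_sub _ _
      _ ≤ 2 * B := by linarith
  have hH2m : Measurable fun p : T × Ω => H p.1 p.2 ^ 2 := hHm.pow_const 2
  have hH2i : Integrable (fun p : T × Ω => H p.1 p.2 ^ 2) (ν.prod P) := by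
    refine Integrable.of_bound hH2m.aestronglyMeasurable ((2 * B) ^ 2) ?_
    filter_upwards [hHB] with p hp
    rw [norm_pow]
    exact pow_le_pow_left₀ (norm_nonneg _) hp 2
  have hGmeas : Measurable fun ω => ∫ t, G t ω ∂ν :=
    ((hG.comp measurable_swap).stronglyMeasurable.integral_prod_right (f := fun ω t => G t ω)
      ).measurable
  have hmean : ∫ ω, ∫ t, G t ω ∂ν ∂P = ∫ t, m t ∂ν := (integral_integral_swap hGi).symm
  rw [variance_eq_integral hGmeas.aemeasurable, hmean]
  have hmi : Integrable m ν := Integrable.of_bound hmm.aestronglyMeasurable B hmB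
  have hswapB : ∀ᵐ ω ∂P, ∀ᵐ t ∂ν, ‖H t ω‖ ≤ 2 * B := by
    have h1 : MeasurableSet {p : T × Ω | ‖H p.1 p.2‖ ≤ 2 * B} :=
      measurableSet_le hHm.norm measurable_const
    rw [← Measure.ae_ae_comm h1]
    exact Measure.ae_ae_of_ae_prod hHB
  -- Jensen's inequality for the square, in the form that the variance in `t` is nonnegative.
  have hle : ∀ᵐ ω ∂P, ((∫ t, G t ω ∂ν) - ∫ t, m t ∂ν) ^ 2 ≤ ∫ t, H t ω ^ 2 ∂ν := by
    filter_upwards [hswapB, hGi.prod_left_ae] with ω hω hGω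
    have hmem : MemLp (fun t => H t ω) 2 ν :=
      MemLp.of_bound (hHm.comp measurable_prodMk_right).aestronglyMeasurable _ hω
    have h0 := variance_nonneg (fun t => H t ω) ν
    rw [variance_eq_sub hmem] at h0
    have hsub : (∫ t, G t ω ∂ν) - ∫ t, m t ∂ν = ∫ t, H t ω ∂ν := (integral_sub hGω hmi).symm
    rw [hsub]
    exact sub_nonneg.1 h0
  calc ∫ ω, ((∫ t, G t ω ∂ν) - ∫ t, m t ∂ν) ^ 2 ∂P
      ≤ ∫ ω, ∫ t, H t ω ^ 2 ∂ν ∂P :=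
        integral_mono_of_nonneg (Eventually.of_forall fun _ => sq_nonneg _)
          hH2i.integral_prod_right hle
    _ = ∫ t, ∫ ω, H t ω ^ 2 ∂P ∂ν :=
        (integral_integral_swap (f := fun t ω => H t ω ^ 2) hH2i).symm
    _ ≤ ∫ _t, V ∂ν := by
        refine integral_mono_ae hH2i.integral_prod_left (integrable_const V) ?_
        filter_upwards [hV] with t ht
        rwa [variance_eq_integral (hG.of_uncurry_left (x := t)).aemeasurable] at ht
    _ = V := by simp

theorem covariance_congr_ae {Ω : Type*} [MeasurableSpace Ω] {P : Measure Ω} {f f' g g' : Ω → ℝ}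
    (hf : f =ᵐ[P] f') (hg : g =ᵐ[P] g') : cov[f, g; P] = cov[f', g'; P] := by
  unfold covariance
  rw [integral_congr_ae hf, integral_congr_ae hg]
  refine integral_congr_ae ?_
  filter_upwards [hf, hg] with ω h₁ h₂
  rw [h₁, h₂]

theorem covariance_comp_vadd {d : ℕ} {Ω : Type*} [MeasurableSpace Ω] {P : Measure Ω}
    [AddAction (Fin d → ℤ) Ω] [MeasurableConstVAdd (Fin d → ℤ) Ω]
    [VAddInvariantMeasure (Fin d → ℤ) Ω P] {f g : Ω → ℝ} (hf : AEStronglyMeasurable f P)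
    (hg : AEStronglyMeasurable g P) (k : Fin d → ℤ) :
    cov[fun ω => f (k +ᵥ ω), fun ω => g (k +ᵥ ω); P] = cov[f, g; P] := by
  have hp : MeasurePreserving (fun ω : Ω => k +ᵥ ω) P P := measurePreserving_vadd k P
  have h := covariance_map_fun (μ := P) (Z := fun ω : Ω => k +ᵥ ω) (X := f) (Y := g)
    (by rwa [hp.map_eq]) (by rwa [hp.map_eq]) hp.measurable.aemeasurable
  rw [hp.map_eq] at h
  exact h.symm

/-! ### Stationary increments and the variance of their box sums. -/

section Field

variable {d : ℕ} {Ω : Type*} [MeasurableSpace Ω] {P : Measure Ω} {Φ : Euc d → Ω → Euc d}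

theorem measurable_spaceGrad (hLip : ∀ ω, ∃ K : ℝ≥0, LipschitzWith K fun x => Φ x ω)
    (hmeas : ∀ x, Measurable (Φ x)) :
    Measurable fun p : Euc d × Ω => spaceGrad Φ p.1 p.2 :=
  measurable_fderiv_process (fun ω => (hLip ω).choose_spec.continuous) hmeas

theorem measurable_partialComp (hLip : ∀ ω, ∃ K : ℝ≥0, LipschitzWith K fun x => Φ x ω)
    (hmeas : ∀ x, Measurable (Φ x)) (l n : Fin d) :
    Measurable fun p : Euc d × Ω => partialComp Φ l n p.1 p.2 := by
  have h := (ContinuousLinearMap.measurable_apply (𝕜 := ℝ) (F := Euc d)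
    (basisVec l : Euc d)).comp (measurable_spaceGrad hLip hmeas)
  exact ((EuclideanSpace.proj (𝕜 := ℝ) n).continuous.measurable).comp h

theorem exists_add_intVec_mem_unitCell (y : Euc d) :
    ∃ m : Fin d → ℤ, y + intVec m ∈ unitCell d := by
  refine ⟨fun i => -⌊y i⌋, fun i => ?_⟩
  simp only [PiLp.add_apply, intVec_apply, Set.mem_Ico]
  push_cast
  exact ⟨by linarith [Int.floor_le (y i)], by linarith [Int.lt_floor_add_one (y i)]⟩

theorem norm_basisVec (l : Fin d) : ‖(basisVec l : Euc d)‖ = 1 := by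
  simp [basisVec]

theorem ae_norm_sub_le (hLip : ∀ ω, ∃ K : ℝ≥0, LipschitzWith K fun x => Φ x ω) {M : ℝ}
    (hM : ∀ᵐ ω ∂P, ∀ᵐ x : Euc d, ‖spaceGrad Φ x ω‖ ≤ M) :
    ∀ᵐ ω ∂P, ∀ x y, ‖Φ y ω - Φ x ω‖ ≤ M * ‖y - x‖ := by
  filter_upwards [hM] with ω hω x y
  exact (hLip ω).choose_spec.norm_sub_le_of_ae_norm_fderiv_le hω x y

theorem ae_ae_differentiableAt [SFinite P] (hLip : ∀ ω, ∃ K : ℝ≥0, LipschitzWith K fun x => Φ x ω)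
    (hmeas : ∀ x, Measurable (Φ x)) :
    ∀ᵐ x : Euc d, ∀ᵐ ω ∂P, DifferentiableAt ℝ (fun y => Φ y ω) x := by
  rw [Measure.ae_ae_comm (measurableSet_differentiableAt_process
    (fun ω => (hLip ω).choose_spec.continuous) hmeas)]
  exact Eventually.of_forall fun ω => (hLip ω).choose_spec.ae_differentiableAt

theorem ae_ae_norm_spaceGrad_le [SFinite P] (hLip : ∀ ω, ∃ K : ℝ≥0, LipschitzWith K fun x => Φ x ω)
    (hmeas : ∀ x, Measurable (Φ x)) {M : ℝ}
    (hM : ∀ᵐ ω ∂P, ∀ᵐ x : Euc d, ‖spaceGrad Φ x ω‖ ≤ M) :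
    ∀ᵐ x : Euc d, ∀ᵐ ω ∂P, ‖spaceGrad Φ x ω‖ ≤ M := by
  have hset : MeasurableSet {p : Euc d × Ω | ‖spaceGrad Φ p.1 p.2‖ ≤ M} :=
    measurableSet_le (measurable_spaceGrad hLip hmeas).norm measurable_const
  rwa [Measure.ae_ae_comm hset]

variable [AddAction (Fin d → ℤ) Ω] [MeasurableConstVAdd (Fin d → ℤ) Ω]

/-- If the gradient is stationary, so are the increments. -/
theorem ae_increment_stationary [SFinite P] (hLip : ∀ ω, ∃ K : ℝ≥0, LipschitzWith K fun x => Φ x ω)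
    (hmeas : ∀ x, Measurable (Φ x))
    (hstat : ∀ᵐ x : Euc d, ∀ k : Fin d → ℤ, ∀ᵐ ω ∂P,
      spaceGrad Φ (x + intVec k) ω = spaceGrad Φ x (k +ᵥ ω)) (k : Fin d → ℤ) :
    ∀ᵐ ω ∂P, ∀ x y, Φ (x + intVec k) ω - Φ (y + intVec k) ω
      = Φ x (k +ᵥ ω) - Φ y (k +ᵥ ω) := by
  have hm := measurable_spaceGrad hLip hmeas
  have hset : MeasurableSet {p : Euc d × Ω |
      spaceGrad Φ (p.1 + intVec k) p.2 = spaceGrad Φ p.1 (k +ᵥ p.2)} := by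
    refine measurableSet_eq_fun ?_ ?_
    · exact hm.comp ((measurable_fst.add_const _).prodMk measurable_snd)
    · exact hm.comp (measurable_fst.prodMk (measurable_snd.const_vadd k))
  have hswap : ∀ᵐ ω ∂P, ∀ᵐ x : Euc d,
      spaceGrad Φ (x + intVec k) ω = spaceGrad Φ x (k +ᵥ ω) := by
    rw [← Measure.ae_ae_comm hset]
    filter_upwards [hstat] with x hx using hx k
  filter_upwards [hswap] with ω hω x y
  obtain ⟨K₁, h₁⟩ := hLip ω
  obtain ⟨K₂, h₂⟩ := hLip (k +ᵥ ω)
  have h₁' : LipschitzWith K₁ fun x => Φ (x + intVec k) ω := by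
    have := h₁.comp (isometry_add_right (intVec k : Euc d)).lipschitz
    rwa [mul_one] at this
  -- The translated and the shifted path have the same gradient almost everywhere, so their
  -- difference is Lipschitz with constant `0`, that is, constant.
  have hz : ∀ᵐ x : Euc d,
      ‖fderiv ℝ (fun x => Φ (x + intVec k) ω - Φ x (k +ᵥ ω)) x‖ ≤ 0 := by
    filter_upwards [hω, h₁'.ae_differentiableAt (μ := volume),
      h₂.ae_differentiableAt (μ := volume)] with x hx hd₁ hd₂
    rw [fderiv_fun_sub hd₁ hd₂, fderiv_comp_add_right (f := fun x => Φ x ω)]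
    unfold spaceGrad at hx
    rw [hx, sub_self, norm_zero]
  have := (h₁'.sub h₂).norm_sub_le_of_ae_norm_fderiv_le hz y x
  rw [zero_mul] at this
  have h0 := norm_le_zero_iff.1 this
  rw [sub_eq_zero] at h0
  rw [sub_eq_sub_iff_sub_eq_sub]
  exact h0

variable [VAddInvariantMeasure (Fin d → ℤ) Ω P]

/-- The covariance bound, assumed on the unit cell, for the stationary field over any point. -/
theorem ae_covariance_orbit_le (hLip : ∀ ω, ∃ K : ℝ≥0, LipschitzWith K fun x => Φ x ω)
    (hmeas : ∀ x, Measurable (Φ x))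
    (hstat : ∀ᵐ x : Euc d, ∀ k : Fin d → ℤ, ∀ᵐ ω ∂P,
      spaceGrad Φ (x + intVec k) ω = spaceGrad Φ x (k +ᵥ ω))
    {w : (Fin d → ℤ) → ℝ}
    (hcov : ∀ᵐ x : Euc d, x ∈ unitCell d → ∀ (k : Fin d → ℤ) (l l' n : Fin d),
        cov[partialComp Φ l n (x + intVec k), partialComp Φ l' n x; P] ≤ w k) :
    ∀ᵐ y : Euc d, ∀ (k k' : Fin d → ℤ) (l n : Fin d),
      cov[fun ω => partialComp Φ l n y (k +ᵥ ω), fun ω => partialComp Φ l n y (k' +ᵥ ω); P]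
        ≤ w (k - k') := by
  have htrans : ∀ᵐ y : Euc d, ∀ m : Fin d → ℤ,
      (y + intVec m ∈ unitCell d → ∀ (k : Fin d → ℤ) (l l' n : Fin d),
        cov[partialComp Φ l n (y + intVec m + intVec k), partialComp Φ l' n (y + intVec m); P]
          ≤ w k) ∧
      ∀ k : Fin d → ℤ, ∀ᵐ ω ∂P,
        spaceGrad Φ (y + intVec m + intVec k) ω = spaceGrad Φ (y + intVec m) (k +ᵥ ω) := by
    rw [ae_all_iff]
    intro m
    exact (measurePreserving_add_right volume (intVec m : Euc d)).quasiMeasurePreserving.ae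
      (hcov.and hstat)
  filter_upwards [htrans] with y hy k k' l n
  obtain ⟨m, hm⟩ := exists_add_intVec_mem_unitCell y
  set z := y + intVec m with hz
  have hfm : Measurable (partialComp Φ l n z) :=
    (measurable_partialComp hLip hmeas l n).comp measurable_prodMk_left
  have hfield : ∀ k : Fin d → ℤ, partialComp Φ l n (z + intVec k)
      =ᵐ[P] fun ω => partialComp Φ l n z (k +ᵥ ω) := by
    intro k
    filter_upwards [(hy m).2 k] with ω hω
    simp only [partialComp]
    rw [hω]
  have hyz : z + intVec (-m) = y := by rw [hz, intVec_neg]; abel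
  -- With `y = z - m`, the shift by `k` over `y` is the shift by `k - m` over `z`. It is split so
  -- that the factor `k' - m`, common to both arguments, disappears by invariance.
  have horbit : ∀ k : Fin d → ℤ, (fun ω => partialComp Φ l n y (k +ᵥ ω))
      =ᵐ[P] fun ω => partialComp Φ l n z ((k - k') +ᵥ ((k' - m) +ᵥ ω)) := by
    intro k
    have h := (measurePreserving_vadd k P).quasiMeasurePreserving.ae (hfield (-m))
    filter_upwards [h] with ω hω
    rw [hyz] at hω
    rw [hω, vadd_vadd, vadd_vadd]
    congr 2
    abel
  have horbit' : (fun ω => partialComp Φ l n y (k' +ᵥ ω))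
      =ᵐ[P] fun ω => partialComp Φ l n z ((k' - m) +ᵥ ω) := by
    simpa using horbit k'
  calc cov[fun ω => partialComp Φ l n y (k +ᵥ ω), fun ω => partialComp Φ l n y (k' +ᵥ ω); P]
      = cov[fun ω => partialComp Φ l n z ((k - k') +ᵥ ((k' - m) +ᵥ ω)),
          fun ω => partialComp Φ l n z ((k' - m) +ᵥ ω); P] :=
        covariance_congr_ae (horbit k) horbit'
    _ = cov[fun ω => partialComp Φ l n z ((k - k') +ᵥ ω), partialComp Φ l n z; P] :=
        covariance_comp_vadd (f := fun ω => partialComp Φ l n z ((k - k') +ᵥ ω))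
          (hfm.comp (measurable_const_vadd (k - k'))).aestronglyMeasurable
          hfm.aestronglyMeasurable (k' - m)
    _ = cov[partialComp Φ l n (z + intVec (k - k')), partialComp Φ l n z; P] :=
        covariance_congr_ae (hfield (k - k')).symm EventuallyEq.rfl
    _ ≤ w (k - k') := (hy m).1 hm _ _ _ _

variable [IsProbabilityMeasure P]

/-- Around almost every base point, the sums of the stationary unit increments over a box have a
variance controlled by the covariances of the gradient. -/
theorem ae_variance_sum_increment_le
    (hLip : ∀ ω, ∃ K : ℝ≥0, LipschitzWith K fun x => Φ x ω)
    (hmeas : ∀ x, Measurable (Φ x)) {M : ℝ}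
    (hM : ∀ᵐ ω ∂P, ∀ᵐ x : Euc d, ‖spaceGrad Φ x ω‖ ≤ M)
    (hstat : ∀ᵐ x : Euc d, ∀ k : Fin d → ℤ, ∀ᵐ ω ∂P,
      spaceGrad Φ (x + intVec k) ω = spaceGrad Φ x (k +ᵥ ω))
    {w : (Fin d → ℤ) → ℝ}
    (hcov : ∀ᵐ x : Euc d, x ∈ unitCell d → ∀ (k : Fin d → ℤ) (l l' n : Fin d),
        cov[partialComp Φ l n (x + intVec k), partialComp Φ l' n x; P] ≤ w k) :
    ∀ᵐ x : Euc d, ∀ (l n : Fin d) (s : Finset (Fin d → ℤ)),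
      Var[fun ω => ∑ k ∈ s, (Φ (x + basisVec l) (k +ᵥ ω) n - Φ x (k +ᵥ ω) n); P]
        ≤ ∑ k' ∈ s, ∑ k ∈ s, w (k - k') := by
  have hpt := (ae_ae_differentiableAt (P := P) hLip hmeas).and
    ((ae_ae_norm_spaceGrad_le hLip hmeas hM).and
      (ae_covariance_orbit_le hLip hmeas hstat hcov))
  -- The pointwise information must hold along the segments from `x` in all coordinate directions,
  -- which by Fubini is so for almost every `x`.
  have hline := ae_all_iff.2 fun l : Fin d => ae_ae_line_of_ae hpt (basisVec l)
  filter_upwards [hline] with x hx l n s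
  have hdiffset : MeasurableSet {p : ℝ × Ω |
      DifferentiableAt ℝ (fun y => Φ y p.2) (x + p.1 • basisVec l)} := by
    have hmap : Measurable fun p : ℝ × Ω => ((x + p.1 • basisVec l : Euc d), p.2) := by
      fun_prop
    exact hmap (measurableSet_differentiableAt_process
      (fun ω => (hLip ω).choose_spec.continuous) hmeas)
  have hdiff : ∀ᵐ ω ∂P, ∀ᵐ t : ℝ,
      DifferentiableAt ℝ (fun y => Φ y ω) (x + t • basisVec l) := by
    rw [← Measure.ae_ae_comm hdiffset]
    filter_upwards [hx l] with t ht using ht.1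
  set ν : Measure ℝ := volume.restrict (Set.Ioc 0 1) with hν
  have : IsProbabilityMeasure ν := ⟨by simp [hν]⟩
  have hνae : ae ν ≤ ae (volume : Measure ℝ) := ae_mono Measure.restrict_le_self
  set f : ℝ → Ω → ℝ := fun t ω => partialComp Φ l n (x + t • basisVec l) ω with hf
  have hfm : Measurable (Function.uncurry f) := by
    have hmap : Measurable fun p : ℝ × Ω => ((x + p.1 • basisVec l : Euc d), p.2) := by
      fun_prop
    exact (measurable_partialComp hLip hmeas l n).comp hmap
  have hfB : ∀ᵐ t ∂ν, ∀ᵐ ω ∂P, |f t ω| ≤ M := by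
    refine hνae ?_
    filter_upwards [hx l] with t ht
    filter_upwards [ht.2.1] with ω hω
    calc |f t ω| ≤ ‖spaceGrad Φ (x + t • basisVec l) ω (basisVec l)‖ :=
          PiLp.norm_apply_le (spaceGrad Φ (x + t • basisVec l) ω (basisVec l)) n
      _ ≤ ‖spaceGrad Φ (x + t • basisVec l) ω‖ * ‖(basisVec l : Euc d)‖ :=
          ContinuousLinearMap.le_opNorm _ _
      _ ≤ M := by rwa [norm_basisVec, mul_one]
  have hinc : ∀ᵐ ω ∂P, Φ (x + basisVec l) ω n - Φ x ω n = ∫ t, f t ω ∂ν := by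
    filter_upwards [hdiff] with ω hω
    have := (hLip ω).choose_spec.integral_fderiv_line_eq_sub hω (EuclideanSpace.proj (𝕜 := ℝ) n)
    rw [intervalIntegral.integral_of_le zero_le_one] at this
    exact this.symm
  have hGm : ∀ k : Fin d → ℤ, Measurable fun p : ℝ × Ω => f p.1 (k +ᵥ p.2) := fun k =>
    hfm.comp (measurable_fst.prodMk (measurable_snd.const_vadd k))
  have hfBk : ∀ᵐ t ∂ν, ∀ k : Fin d → ℤ, ∀ᵐ ω ∂P, |f t (k +ᵥ ω)| ≤ M := by
    filter_upwards [hfB] with t ht k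
    exact (measurePreserving_vadd k P).quasiMeasurePreserving.ae ht
  set G : ℝ → Ω → ℝ := fun t ω => ∑ k ∈ s, f t (k +ᵥ ω) with hG
  have hGmeas : Measurable (Function.uncurry G) :=
    Finset.measurable_fun_sum s fun k _ => hGm k
  have hGB : ∀ᵐ t ∂ν, ∀ᵐ ω ∂P, |G t ω| ≤ ∑ _k ∈ s, M := by
    filter_upwards [hfBk] with t ht
    have := ae_all_iff.2 ht
    filter_upwards [this] with ω hω
    exact (Finset.abs_sum_le_sum_abs _ _).trans (Finset.sum_le_sum fun k _ => hω k)
  have hGV : ∀ᵐ t ∂ν, Var[G t; P] ≤ ∑ k' ∈ s, ∑ k ∈ s, w (k - k') := by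
    filter_upwards [hfBk, hνae (hx l)] with t ht htx
    have hmem : ∀ k ∈ s, MemLp (fun ω => f t (k +ᵥ ω)) 2 P := fun k _ =>
      MemLp.of_bound ((hGm k).comp measurable_prodMk_left).aestronglyMeasurable M (ht k)
    rw [hG, variance_fun_sum' hmem, Finset.sum_comm]
    exact Finset.sum_le_sum fun k' _ => Finset.sum_le_sum fun k _ => htx.2.2 k k' l n
  have hfint : ∀ᵐ ω ∂P, ∀ k : Fin d → ℤ, Integrable (fun t => f t (k +ᵥ ω)) ν := by
    rw [ae_all_iff]
    intro k
    have hk : ∀ᵐ p ∂ν.prod P, ‖f p.1 (k +ᵥ p.2)‖ ≤ M := by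
      rw [Measure.ae_prod_iff_ae_ae (measurableSet_le (hGm k).norm measurable_const)]
      filter_upwards [hfBk] with t ht using ht k
    exact (Integrable.of_bound (hGm k).aestronglyMeasurable M hk).prod_left_ae
  have hincG : (fun ω => ∑ k ∈ s, (Φ (x + basisVec l) (k +ᵥ ω) n - Φ x (k +ᵥ ω) n))
      =ᵐ[P] fun ω => ∫ t, G t ω ∂ν := by
    have hinck : ∀ᵐ ω ∂P, ∀ k : Fin d → ℤ,
        Φ (x + basisVec l) (k +ᵥ ω) n - Φ x (k +ᵥ ω) n = ∫ t, f t (k +ᵥ ω) ∂ν := by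
      rw [ae_all_iff]
      exact fun k => (measurePreserving_vadd k P).quasiMeasurePreserving.ae hinc
    filter_upwards [hinck, hfint] with ω hω hωi
    rw [hG, integral_finsetSum s fun k _ => hωi k]
    exact Finset.sum_congr rfl fun k _ => hω k
  rw [variance_congr hincG]
  exact variance_integral_le hGmeas hGB hGV

end Field

/-! ### The Koopman action on `L²`. -/

section Koopman

variable {d : ℕ} {Ω : Type*} [MeasurableSpace Ω] {P : Measure Ω}
  [AddAction (Fin d → ℤ) Ω] [MeasurableConstVAdd (Fin d → ℤ) Ω]
  [VAddInvariantMeasure (Fin d → ℤ) Ω P]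

variable (P) in
/-- The Koopman isometries `f ↦ f ∘ θ_k` of `L²(Ω)`. -/
noncomputable def koopman (k : Fin d → ℤ) : Lp ℝ 2 P →ₗᵢ[ℝ] Lp ℝ 2 P :=
  Lp.compMeasurePreservingₗᵢ ℝ (fun ω => k +ᵥ ω) (measurePreserving_vadd k P)

theorem coeFn_koopman (k : Fin d → ℤ) (f : Lp ℝ 2 P) :
    koopman P k f =ᵐ[P] fun ω => f (k +ᵥ ω) :=
  Lp.coeFn_compMeasurePreserving f (measurePreserving_vadd k P)

theorem koopman_add (k m : Fin d → ℤ) (f : Lp ℝ 2 P) :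
    koopman P (k + m) f = koopman P k (koopman P m f) := by
  refine Lp.ext ?_
  filter_upwards [coeFn_koopman (k + m) f, coeFn_koopman k (koopman P m f),
    (measurePreserving_vadd k P).quasiMeasurePreserving.ae (coeFn_koopman m f)] with ω h₁ h₂ h₃
  rw [h₁, h₂, h₃, vadd_vadd, add_comm]

theorem norm_sq_eq_integral (f : Lp ℝ 2 P) : ‖f‖ ^ 2 = ∫ ω, f ω ^ 2 ∂P := by
  rw [← real_inner_self_eq_norm_sq, L2.inner_def]
  refine integral_congr_ae (Eventually.of_forall fun ω => ?_)
  simp [sq]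

theorem integral_comp_vadd (k : Fin d → ℤ) {E : Type*} [NormedAddCommGroup E] [NormedSpace ℝ E]
    {f : Ω → E} (hf : AEStronglyMeasurable f P) : ∫ ω, f (k +ᵥ ω) ∂P = ∫ ω, f ω ∂P := by
  have hp := measurePreserving_vadd k P
  have h := integral_map (μ := P) (φ := fun ω : Ω => k +ᵥ ω) (f := f)
    hp.measurable.aemeasurable (by rwa [hp.map_eq])
  rw [hp.map_eq] at h
  exact h.symm

/-- The box averages of a centred random variable in `L²` are given by variances. -/
theorem norm_sq_boxAverage_toLp [IsProbabilityMeasure P] {g : Ω → ℝ} (hg : MemLp g 2 P)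
    (hf : MemLp (fun ω => g ω - ∫ ω', g ω' ∂P) 2 P) (N : ℕ) :
    ‖boxAverage (koopman (d := d) P) N hf.toLp‖ ^ 2
      = (((N : ℝ) ^ d)⁻¹) ^ 2 * Var[fun ω => ∑ k ∈ latticeBox d N, g (k +ᵥ ω); P] := by
  have hgk : ∀ k : Fin d → ℤ, MemLp (fun ω => g (k +ᵥ ω)) 2 P := fun k =>
    hg.comp_measurePreserving (measurePreserving_vadd k P)
  set I := ∫ ω', g ω' ∂P with hI
  have hmean : ∫ ω, ∑ k ∈ latticeBox d N, g (k +ᵥ ω) ∂P = ∑ _k ∈ latticeBox d N, I := by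
    rw [integral_finsetSum _ fun k _ => (hgk k).integrable (by norm_num)]
    exact Finset.sum_congr rfl fun k _ => integral_comp_vadd k hg.aestronglyMeasurable
  rw [boxAverage, norm_smul, mul_pow, norm_inv, norm_pow, Real.norm_natCast, norm_sq_eq_integral,
    variance_eq_integral (memLp_finsetSum _ fun k _ => hgk k).aemeasurable, hmean]
  congr 1
  refine integral_congr_ae ?_
  have hk : ∀ᵐ ω ∂P, ∀ k : Fin d → ℤ, koopman P k hf.toLp ω = g (k +ᵥ ω) - I := by
    rw [ae_all_iff]
    intro k
    filter_upwards [coeFn_koopman k hf.toLp,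
      (measurePreserving_vadd k P).quasiMeasurePreserving.ae hf.coeFn_toLp] with ω h₁ h₂
    rw [h₁, h₂]
  filter_upwards [hk, Lp.coeFn_finsetSum (latticeBox d N) fun k => koopman P k hf.toLp]
    with ω h₁ h₂
  rw [h₂, Finset.sum_apply, ← Finset.sum_sub_distrib]
  simp only [h₁]

end Koopman

/-! ### From the coboundary to the corrector. -/

section Field

variable {d : ℕ} {Ω : Type*} [MeasurableSpace Ω] {P : Measure Ω} [IsProbabilityMeasure P]
  [AddAction (Fin d → ℤ) Ω] [MeasurableConstVAdd (Fin d → ℤ) Ω]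
  [VAddInvariantMeasure (Fin d → ℤ) Ω P]
  {Φ : Euc d → Ω → Euc d}

/-- The mean increment does not depend on the base point. -/
theorem integral_increment_eq_meanIncrement (hmeas : ∀ x, Measurable (Φ x)) {M : ℝ}
    (hbound : ∀ᵐ ω ∂P, ∀ x y, ‖Φ y ω - Φ x ω‖ ≤ M * ‖y - x‖)
    (hinc : ∀ k : Fin d → ℤ, ∀ᵐ ω ∂P, ∀ x y, Φ (x + intVec k) ω - Φ (y + intVec k) ω
      = Φ x (k +ᵥ ω) - Φ y (k +ᵥ ω)) (x : Euc d) (l : Fin d) :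
    ∫ ω, (Φ (x + basisVec l) ω - Φ x ω) ∂P = meanIncrement P Φ l := by
  have hint : ∀ x y, Integrable (fun ω => Φ y ω - Φ x ω) P := fun x y =>
    Integrable.of_bound ((hmeas y).sub (hmeas x)).aestronglyMeasurable (M * ‖y - x‖)
      (hbound.mono fun ω h => h x y)
  set k : Fin d → ℤ := Pi.single l 1 with hk
  have hkv : (intVec k : Euc d) = basisVec l := intVec_single l
  -- The increments at `x` and at `0` differ by a coboundary of `Φ x - Φ 0`, whose mean vanishes by
  -- invariance.
  have hpt : (fun ω => Φ (x + basisVec l) ω - Φ x ω) =ᵐ[P] fun ω =>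
      (Φ (basisVec l) ω - Φ 0 ω) + ((Φ x (k +ᵥ ω) - Φ 0 (k +ᵥ ω)) - (Φ x ω - Φ 0 ω)) := by
    filter_upwards [hinc k] with ω hω
    rw [← hω x 0, hkv, zero_add]
    abel
  have hsh : Integrable (fun ω => Φ x (k +ᵥ ω) - Φ 0 (k +ᵥ ω)) P :=
    (measurePreserving_vadd k P).integrable_comp_of_integrable (hint 0 x)
  have hdiff : Integrable
      (fun ω => (Φ x (k +ᵥ ω) - Φ 0 (k +ᵥ ω)) - (Φ x ω - Φ 0 ω)) P := hsh.sub (hint _ _)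
  rw [integral_congr_ae hpt, integral_add (hint _ _) hdiff,
    integral_sub hsh (hint _ _),
    integral_comp_vadd k (f := fun ω => Φ x ω - Φ 0 ω) (hint 0 x).aestronglyMeasurable, sub_self,
    add_zero, meanIncrement]

theorem exists_stationary_corrector_of_lipschitz (hd : 2 < d)
    (hLip : ∀ ω, ∃ K : ℝ≥0, LipschitzWith K fun x => Φ x ω)
    (hmeas : ∀ x, Measurable (Φ x)) (hL2 : MemLp (Φ 0) 2 P) {M : ℝ}
    (hM : ∀ᵐ ω ∂P, ∀ᵐ x : Euc d, ‖spaceGrad Φ x ω‖ ≤ M)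
    (hstat : ∀ᵐ x : Euc d, ∀ k : Fin d → ℤ, ∀ᵐ ω ∂P,
      spaceGrad Φ (x + intVec k) ω = spaceGrad Φ x (k +ᵥ ω))
    {α : ℝ} (hα : 2 < α) {C : ℝ}
    (hcov : ∀ᵐ x : Euc d, x ∈ unitCell d → ∀ (k : Fin d → ℤ) (l l' n : Fin d),
        cov[partialComp Φ l n (x + intVec k), partialComp Φ l' n x; P]
          ≤ C * (1 / (1 + ‖(intVec k : Euc d)‖ ^ α))) :
    ∃ W : Ω → Euc d, MemLp W 2 P ∧ ∀ k : Fin d → ℤ, ∀ᵐ ω ∂P, ∀ x,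
      Φ (x + intVec k) ω + W ω
        = Φ x (k +ᵥ ω) + W (k +ᵥ ω) + ∑ l, (k l : ℝ) • meanIncrement P Φ l := by
  have hbound := ae_norm_sub_le hLip hM
  have hinc := ae_increment_stationary hLip hmeas hstat
  -- One good base point is enough: stationary increments carry the identity obtained there to every
  -- other point.
  obtain ⟨x, hx⟩ := (ae_variance_sum_increment_le hLip hmeas hM hstat hcov).exists
  obtain ⟨γ, hγ, K, hK, hsum⟩ := exists_sum_latticeBox_decay_le hd hα
  have hmemE : ∀ y z, MemLp (fun ω => Φ z ω - Φ y ω) 2 P := fun y z =>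
    MemLp.of_bound ((hmeas z).sub (hmeas y)).aestronglyMeasurable (M * ‖z - y‖)
      (hbound.mono fun ω h => h y z)
  have hmem : ∀ y z n, MemLp (fun ω => Φ z ω n - Φ y ω n) 2 P := fun y z n =>
    (hmemE y z).eval_piLp n
  have hΦx : MemLp (Φ x) 2 P := by
    have := (hmemE 0 x).add hL2
    refine this.congr_norm (hmeas x).aestronglyMeasurable (Eventually.of_forall fun ω => ?_)
    simp
  set drift : (Fin d → ℤ) → Fin d → ℝ := fun k n =>
    ∑ l, (k l : ℝ) * meanIncrement P Φ l n with hdrift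
  have hdrift_add : ∀ k m n, drift (k + m) n = drift k n + drift m n := by
    intro k m n
    simp only [hdrift, Pi.add_apply, Int.cast_add, add_mul, Finset.sum_add_distrib]
  have hdrift_single : ∀ l n, drift (Pi.single l 1) n = meanIncrement P Φ l n := by
    intro l n
    simp only [hdrift]
    rw [Finset.sum_eq_single l]
    · simp
    · intro b _ hb
      simp [Pi.single_eq_of_ne hb]
    · simp
  have hf : ∀ n k, MemLp (fun ω => Φ (x + intVec k) ω n - Φ x ω n - drift k n) 2 P := fun n k =>
    (hmem x _ n).sub (memLp_const _)
  have hcoboundary : ∀ n, ∃ Y : Lp ℝ 2 P, ∀ k, (hf n k).toLp = Y - koopman P k Y := by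
    intro n
    -- The variances of the averages decay like `N ^ (-γ)`, hence the norms like `N ^ (-γ / 2)`;
    -- `|C|` is taken because `C` has no sign.
    refine exists_coboundary_of_boxAverage_decay (U := koopman P)
      (c := fun k => (hf n k).toLp) koopman_add ?_ (γ := γ / 2) (K := √(|C| * K))
      (by linarith) (Real.sqrt_nonneg _) ?_
    · intro k m
      refine Lp.ext ?_
      filter_upwards [(hf n (k + m)).coeFn_toLp, (hf n m).coeFn_toLp,
        Lp.coeFn_add (hf n m).toLp (koopman P m (hf n k).toLp), coeFn_koopman m (hf n k).toLp,
        (measurePreserving_vadd m P).quasiMeasurePreserving.ae (hf n k).coeFn_toLp, hinc m]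
        with ω h₁ h₂ h₃ h₄ h₅ h₆
      rw [h₁, h₃, Pi.add_apply, h₂, h₄, h₅, hdrift_add, intVec_add, ← add_assoc]
      have := congrArg (fun v : Euc d => v n) (h₆ (x + intVec k) x)
      simp only [PiLp.sub_apply] at this
      linarith
    · intro l N hN
      have hmean : ∫ ω, (Φ (x + basisVec l) ω n - Φ x ω n) ∂P = drift (Pi.single l 1) n := by
        rw [hdrift_single, ← integral_increment_eq_meanIncrement hmeas hbound hinc x l,
          eval_integral_piLp fun i => (hmem x _ i).integrable (by norm_num)]
        rfl
      have hcl : MemLp (fun ω => (Φ (x + basisVec l) ω n - Φ x ω n)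
          - ∫ ω', (Φ (x + basisVec l) ω' n - Φ x ω' n) ∂P) 2 P :=
        (hmem x _ n).sub (memLp_const _)
      have heq : (hf n (Pi.single l 1)).toLp = hcl.toLp := by
        rw [MemLp.toLp_eq_toLp_iff]
        refine Eventually.of_forall fun ω => ?_
        simp only [hmean, intVec_single]
      have hN0 : (0 : ℝ) < N := by exact_mod_cast hN
      have hvar : Var[fun ω => ∑ k ∈ latticeBox d N,
            (Φ (x + basisVec l) (k +ᵥ ω) n - Φ x (k +ᵥ ω) n); P]
          ≤ (N : ℝ) ^ d * (|C| * (K * (N : ℝ) ^ ((d : ℝ) - γ))) := by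
        refine (hx l n (latticeBox d N)).trans ?_
        calc _ ≤ ∑ _k' ∈ latticeBox d N, |C| * (K * (N : ℝ) ^ ((d : ℝ) - γ)) := by
              refine Finset.sum_le_sum fun k' hk' => ?_
              rw [← Finset.mul_sum]
              have h0 : 0 ≤ ∑ k ∈ latticeBox d N, 1 / (1 + ‖(intVec (k - k') : Euc d)‖ ^ α) :=
                Finset.sum_nonneg fun k _ => by positivity
              exact (mul_le_mul_of_nonneg_right (le_abs_self C) h0).trans
                (mul_le_mul_of_nonneg_left (hsum N hN k' hk') (abs_nonneg C))
          _ = _ := by rw [Finset.sum_const, card_latticeBox]; simp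
      refine le_of_sq_le_sq ?_ (by positivity)
      rw [heq, norm_sq_boxAverage_toLp (hmem x _ n) hcl N, mul_pow,
        Real.sq_sqrt (by positivity), ← Real.rpow_natCast (_ ^ _) 2, ← Real.rpow_mul hN0.le]
      calc _ ≤ (((N : ℝ) ^ d)⁻¹) ^ 2 * ((N : ℝ) ^ d * (|C| * (K * (N : ℝ) ^ ((d : ℝ) - γ)))) := by
            gcongr
        _ = |C| * K * ((N : ℝ) ^ (((d : ℝ) - γ)) / (N : ℝ) ^ d) := by field_simp
        _ = _ := by
            rw [← Real.rpow_natCast (N : ℝ) d, ← Real.rpow_sub hN0]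
            congr 2
            push_cast
            ring
  choose Y hY using hcoboundary
  -- With this choice `Φ x + W = -Y`, and the coboundary equation at `x` becomes stationarity up to
  -- the drift.
  refine ⟨fun ω => WithLp.toLp 2 fun n => -Y n ω - Φ x ω n, ?_, fun k => ?_⟩
  · refine MemLp.of_eval_piLp fun n => ?_
    exact ((Lp.memLp (Y n)).neg).sub (hΦx.eval_piLp n)
  · have hYk : ∀ᵐ ω ∂P, ∀ n, Φ (x + intVec k) ω n - Φ x ω n - drift k n
        = Y n ω - Y n (k +ᵥ ω) := by
      rw [ae_all_iff]
      intro n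
      have h := (hf n k).coeFn_toLp
      rw [hY n k] at h
      filter_upwards [h, Lp.coeFn_sub (Y n) (koopman P k (Y n)), coeFn_koopman k (Y n)]
        with ω h₁ h₂ h₃
      rw [← h₁, h₂, Pi.sub_apply, h₃]
    filter_upwards [hYk, hinc k] with ω h₁ h₂ y
    ext n
    have h₃ := congrArg (fun v : Euc d => v n) (h₂ y x)
    simp only [PiLp.sub_apply] at h₃
    have h₄ := h₁ n
    have h₅ : (∑ l, (k l : ℝ) • meanIncrement P Φ l) n = drift k n := by
      simp [hdrift]
    simp only [PiLp.add_apply, h₅]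
    linarith

end Field

/-! ### Constant fields in `W^{1,∞}` and removal of the exceptional null event. -/

section Corrector

variable {d : ℕ}

theorem volume_unitCell_lt_top (d : ℕ) : volume (unitCell d) < ∞ := by
  refine (Bornology.IsBounded.subset (Metric.isBounded_closedBall (x := (0 : Euc d)) (r := √d))
    fun x hx => ?_).measure_lt_top
  rw [mem_closedBall_zero_iff, EuclideanSpace.norm_eq]
  refine Real.sqrt_le_sqrt ?_
  calc ∑ i, ‖x i‖ ^ 2 ≤ ∑ _i : Fin d, (1 : ℝ) := by
        refine Finset.sum_le_sum fun i _ => ?_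
        have := hx i
        rw [Real.norm_eq_abs, abs_of_nonneg this.1]
        exact pow_le_one₀ this.1 this.2.le
    _ = d := by simp

theorem memW1InfPer_const {F : Type*} [NormedAddCommGroup F] [NormedSpace ℝ F]
    [CompleteSpace F] (v : F) : MemW1InfPer fun _ : Euc d => v where
  periodic _ _ := rfl
  memLp := by
    have : IsFiniteMeasure (volume.restrict (unitCell d)) := ⟨by
      simpa using volume_unitCell_lt_top d⟩
    exact memLp_const v
  weakDeriv l := by
    refine ⟨fun _ => 0, fun _ _ => rfl, MemLp.zero, fun φ hφ hc => ?_⟩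
    have hd : Differentiable ℝ φ := hφ.differentiable (by simp)
    have hcd : HasCompactSupport fun x => fderiv ℝ φ x (basisVec l) :=
      hc.fderiv_apply (𝕜 := ℝ) (basisVec l)
    have hcont : Continuous fun x => fderiv ℝ φ x (basisVec l) :=
      (hφ.continuous_fderiv (by simp)).clm_apply continuous_const
    have h0 : ∫ x, fderiv ℝ φ x (basisVec l) = 0 := by
      have := integral_mul_fderiv_eq_neg_fderiv_mul_of_integrable (μ := volume)
        (f := fun _ : Euc d => (1 : ℝ)) (g := φ) (v := basisVec l) (by simp)
        (by simpa using hcont.integrable_of_hasCompactSupport hcd)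
        (by simpa using hd.continuous.integrable_of_hasCompactSupport hc)
        (fun _ _ => differentiableAt_const _) (fun x _ => hd x)
      simpa using this
    rw [integral_smul_const, h0]
    simp

variable {Ω : Type*} [MeasurableSpace Ω]

/-- A random field whose paths are almost surely Lipschitz agrees, off a null event, with one all
of whose paths are Lipschitz. -/
theorem exists_lipschitz_modification {P : Measure Ω} {Φ : Euc d → Ω → Euc d}
    (hmeas : ∀ x, Measurable (Φ x))
    (hLip : ∀ᵐ ω ∂P, ∃ K : ℝ≥0, LipschitzWith K fun x => Φ x ω) :
    ∃ Ψ : Euc d → Ω → Euc d, (∀ x, Measurable (Ψ x)) ∧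
      (∀ ω, ∃ K : ℝ≥0, LipschitzWith K fun x => Ψ x ω) ∧
      ∀ᵐ ω ∂P, ∀ x, Ψ x ω = Φ x ω := by
  classical
  obtain ⟨s, hs, hsm, hs0⟩ := exists_measurable_superset_of_null (ae_iff.1 hLip)
  refine ⟨fun x => s.piecewise 0 (Φ x), fun x => Measurable.piecewise hsm measurable_zero (hmeas x),
    fun ω => ?_, ?_⟩
  · by_cases hω : ω ∈ s
    · refine ⟨0, ?_⟩
      simp only [Set.piecewise_eq_of_mem _ _ _ hω]
      exact LipschitzWith.const _
    · simp only [Set.piecewise_eq_of_notMem _ _ _ hω]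
      by_contra h
      exact hω (hs h)
  · filter_upwards [measure_eq_zero_iff_ae_notMem.1 hs0] with ω hω x
    exact Set.piecewise_eq_of_notMem _ _ _ hω

/-- The corrector can be chosen independent of `x`: the defect of stationarity of `Φ` is constant
in space, and after centring it is the coboundary of a single square integrable random vector. -/
theorem exists_stationary_corrector (hd : 2 < d) {P : Measure Ω} [IsProbabilityMeasure P]
    [AddAction (Fin d → ℤ) Ω] [MeasurableConstVAdd (Fin d → ℤ) Ω]
    [VAddInvariantMeasure (Fin d → ℤ) Ω P] {Φ : Euc d → Ω → Euc d}
    (hmeas : ∀ x, Measurable (Φ x))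
    (hLip : ∀ᵐ ω ∂P, ∃ K : ℝ≥0, LipschitzWith K fun x => Φ x ω)
    (hL2 : MemLp (Φ 0) 2 P) {M : ℝ}
    (hM : ∀ᵐ ω ∂P, ∀ᵐ x : Euc d, ‖spaceGrad Φ x ω‖ ≤ M)
    (hstat : ∀ᵐ x : Euc d, ∀ k : Fin d → ℤ, ∀ᵐ ω ∂P,
      spaceGrad Φ (x + intVec k) ω = spaceGrad Φ x (k +ᵥ ω))
    {α : ℝ} (hα : 2 < α) {C : ℝ}
    (hcov : ∀ᵐ x : Euc d, x ∈ unitCell d → ∀ (k : Fin d → ℤ) (l l' n : Fin d),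
        cov[partialComp Φ l n (x + intVec k), partialComp Φ l' n x; P]
          ≤ C * (1 / (1 + ‖(intVec k : Euc d)‖ ^ α))) :
    ∃ W : Ω → Euc d, MemLp W 2 P ∧ ∀ k : Fin d → ℤ, ∀ᵐ ω ∂P, ∀ x,
      Φ (x + intVec k) ω + W ω
        = Φ x (k +ᵥ ω) + W (k +ᵥ ω) + ∑ l, (k l : ℝ) • meanIncrement P Φ l := by
  -- Joint measurability of the gradient needs continuity of every path. Each hypothesis and the
  -- mean increment pass between `Φ` and `Ψ`, since the null event is independent of `x` and has
  -- null shifts.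
  obtain ⟨Ψ, hΨm, hΨL, hΨ⟩ := exists_lipschitz_modification hmeas hLip
  have hΨk : ∀ k : Fin d → ℤ, ∀ᵐ ω ∂P, ∀ x, Ψ x (k +ᵥ ω) = Φ x (k +ᵥ ω) := fun k =>
    (measurePreserving_vadd k P).quasiMeasurePreserving.ae hΨ
  have hgrad : ∀ ω, (∀ x, Ψ x ω = Φ x ω) → ∀ x, spaceGrad Ψ x ω = spaceGrad Φ x ω := by
    intro ω hω x
    unfold spaceGrad
    simp only [hω]
  have hpart : ∀ l n x, partialComp Ψ l n x =ᵐ[P] partialComp Φ l n x := by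
    intro l n x
    filter_upwards [hΨ] with ω hω
    simp only [partialComp, hgrad ω hω]
  have hmeanInc : ∀ l, meanIncrement P Ψ l = meanIncrement P Φ l := fun l =>
    integral_congr_ae (hΨ.mono fun ω hω => by simp only [hω])
  have hMΨ : ∀ᵐ ω ∂P, ∀ᵐ x : Euc d, ‖spaceGrad Ψ x ω‖ ≤ M := by
    filter_upwards [hM, hΨ] with ω h₁ h₂
    filter_upwards [h₁] with x hx
    rwa [hgrad ω h₂]
  have hstatΨ : ∀ᵐ x : Euc d, ∀ k : Fin d → ℤ, ∀ᵐ ω ∂P,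
      spaceGrad Ψ (x + intVec k) ω = spaceGrad Ψ x (k +ᵥ ω) := by
    filter_upwards [hstat] with x hx k
    filter_upwards [hx k, hΨ, hΨk k] with ω h₁ h₂ h₃
    rw [hgrad ω h₂, hgrad _ h₃, h₁]
  have hcovΨ : ∀ᵐ x : Euc d, x ∈ unitCell d → ∀ (k : Fin d → ℤ) (l l' n : Fin d),
      cov[partialComp Ψ l n (x + intVec k), partialComp Ψ l' n x; P]
        ≤ C * (1 / (1 + ‖(intVec k : Euc d)‖ ^ α)) := by
    filter_upwards [hcov] with x hx hxc k l l' n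
    rw [covariance_congr_ae (hpart l n _) (hpart l' n x)]
    exact hx hxc k l l' n
  obtain ⟨W, hW, hWeq⟩ := exists_stationary_corrector_of_lipschitz hd hΨL hΨm
    (hL2.ae_eq (hΨ.mono fun ω hω => (hω 0).symm)) hMΨ hstatΨ hα hcovΨ
  refine ⟨W, hW, fun k => ?_⟩
  filter_upwards [hWeq k, hΨ, hΨk k] with ω h₁ h₂ h₃ x
  have := h₁ x
  simpa only [h₂, h₃, hmeanInc] using this

end Corrector

/-! ### The periodic corrector. -/

theorem corollary1 {d : ℕ} (hd : 2 < d)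
    {Ω : Type*} [MeasurableSpace Ω] (P : Measure Ω) [IsProbabilityMeasure P]
    -- an ergodic measure-preserving action `θ_k ω = k +ᵥ ω` of `ℤ^d`
    [AddAction (Fin d → ℤ) Ω] [MeasurableConstVAdd (Fin d → ℤ) Ω] [ErgodicVAdd (Fin d → ℤ) Ω P]
    -- a random Lipschitz field, square integrable at the origin
    (Φ : Euc d → Ω → Euc d)
    (hmeas : ∀ x, Measurable (Φ x))
    (hLip : ∀ᵐ ω ∂P, ∃ K : ℝ≥0, LipschitzWith K (fun x => Φ x ω))
    (hL2 : MemLp (Φ 0) 2 P)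
    -- its gradient is uniformly bounded and stationary
    (hbdd : ∃ M : ℝ, ∀ᵐ ω ∂P, ∀ᵐ x : Euc d, ‖spaceGrad Φ x ω‖ ≤ M)
    (hstat : ∀ᵐ x : Euc d, ∀ k : Fin d → ℤ, ∀ᵐ ω ∂P,
      spaceGrad Φ (x + intVec k) ω = spaceGrad Φ x (k +ᵥ ω))
    -- decay of the covariance of the gradient
    (hcov : ∃ α : ℝ, 2 < α ∧ ∃ C : ℝ, ∀ᵐ x : Euc d, x ∈ unitCell d →
      ∀ (k : Fin d → ℤ) (l l' n : Fin d),
        covariance (partialComp Φ l n (x + intVec k)) (partialComp Φ l' n x) P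
          ≤ C * (1 / (1 + ‖(intVec k : Euc d)‖ ^ α))) :
    ∃ X : Euc d → Ω → Euc d,
      Measurable (Function.uncurry X) ∧
      (∀ (k : Fin d → ℤ) (x : Euc d) (ω : Ω), X (x + intVec k) ω = X x ω) ∧
      (∃ u : Euc d → L2zero d P,
        MemW1InfPer u ∧ ∀ x, ((u x : Lp (Euc d) 2 P) : Ω → Euc d) =ᵐ[P] X x) ∧
      ∀ (x : Euc d) (k : Fin d → ℤ), ∀ᵐ ω ∂P,
        Φ (x + intVec k) ω + X (x + intVec k) ω
          = Φ x (k +ᵥ ω) + X x (k +ᵥ ω) + ∑ l, (k l : ℝ) • meanIncrement P Φ l := by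
  obtain ⟨M, hM⟩ := hbdd
  obtain ⟨α, hα, C, hC⟩ := hcov
  obtain ⟨W, hW, hWeq⟩ := exists_stationary_corrector hd hmeas hLip hL2 hM hstat hα hC
  have hWi : Integrable W P := hW.integrable (by norm_num)
  have hV : MemLp (fun ω => W ω - ∫ ω', W ω' ∂P) 2 P := hW.sub (memLp_const _)
  have hVZ := hV.aestronglyMeasurable.ae_eq_mk
  -- `W` is only almost everywhere strongly measurable; a measurable representative of its centred
  -- version makes the spatially constant field jointly measurable.
  set Z : Ω → Euc d := hV.aestronglyMeasurable.mk _ with hZ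
  have hmean : ∫ ω, (hV.toLp _ : Lp (Euc d) 2 P) ω ∂P = 0 := by
    rw [integral_congr_ae hV.coeFn_toLp, integral_sub hWi (integrable_const _)]
    simp
  refine ⟨fun _ => Z, hV.aestronglyMeasurable.stronglyMeasurable_mk.measurable.comp measurable_snd,
    fun _ _ _ => rfl, ⟨fun _ => ⟨hV.toLp _, hmean⟩, memW1InfPer_const _,
      fun _ => hV.coeFn_toLp.trans hVZ⟩, fun x k => ?_⟩
  filter_upwards [hWeq k, hVZ, (measurePreserving_vadd k P).quasiMeasurePreserving.ae hVZ]
    with ω h₁ h₂ h₃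
  rw [← h₂, ← h₃]
  have := h₁ x
  calc Φ (x + intVec k) ω + (W ω - ∫ ω', W ω' ∂P)
      = (Φ (x + intVec k) ω + W ω) - ∫ ω', W ω' ∂P := by abel
    _ = _ := by rw [this]; abel
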